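/- Conventions. $\mathrm{Fin}\times\mathrm{Fin}$ is the ideal on $\mathbb N\times\mathbb N$ consisting of all $X$ such that $\{m:(n,m)\in X\}$ is finite for all but finitely many $n$. A $\mathrm{Fin}\times\mathrm{Fin}$-almost disjoint family is a set $\mathcal A$ of subsets of $\mathbb N\times\mathbb N$, none of them in $\mathrm{Fin}\times\mathrm{Fin}$, such that any two distinct members have their intersection in $\mathrm{Fin}\times\mathrm{Fin}$; it is $\mathrm{Fin}\times\mathrm{Fin}$-mad if it is not a proper subset of another such family. For $A\in[\mathbb N]^\infty$ (the space of infinite subsets of $\mathbb N$), $[A]^\infty$ is the set of infinite subsets of $A$. A set $P\subseteq[\mathbb N]^\infty$ is Ramsey if there is $A\in[\mathbb N]^\infty$ with $[A]^\infty\subseteq P$ or $[A]^\infty\cap P=\emptyset$. A relation $R\subseteq[\mathbb N]^\infty\times[\mathbb N]^\infty$ is total if for every $x$ there is $y$ with $(x,y)\in R$; a function $f:[A]^\infty\to[\mathbb N]^\infty$ uniformises $R$ on $[A]^\infty$ if $(x,f(x))\in R$ for all $x\in[A]^\infty$. A pointclass is a class of subsets of Polish spaces that is closed under continuous preimages and (binary)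 intersections and contains all Borel sets; $f$ is $\Gamma'$-measurable if preimages of open sets are in $\Gamma'$. Power sets of countable sets carry the Cantor topology. A set is Dedekind infinite if $\mathbb N$ injects into it. (1) Let $\Gamma$ be a pointclass. Suppose that for every total relation $R\subseteq[\mathbb N]^\infty\times[\mathbb N]^\infty$ in $\Gamma$ there are $A\in[\mathbb N]^\infty$, a function $f$ which uniformises $R$ on $[A]^\infty$, and a pointclass $\Gamma'$ such that $f$ is $\Gamma'$-measurable and every set $P\subseteq[\mathbb N]^\infty$ in $\Gamma'$ is Ramsey. Then there is no Dedekind infinite $\mathrm{Fin}\times\mathrm{Fin}$-mad family in $\Gamma$. (2) Let $\Gamma$ be the class of all sets, or the class of all (boldface) projective sets, or any pointclass closed under projections along Polish spaces. Suppose that the principle of Dependent Choice holds, that every total relation $R\subseteq[\mathbb N]^\infty\times[\mathbb N]^\infty$ in $\Gamma$ is uniformised on some $[A]^\infty$ by a function whose graph is in $\Gamma$ (Ramsey positive uniformisation), and that every set $P\subseteq[\mathbb N]^\infty$ in $\Gamma$ is Ramsey. Then there is no infinite $\mathrm{Fin}\times\mathrm{Fin}$-mad family in $\Gamma$. -/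

import Mathlib

open Set

namespace FinTwoMad

/-! ### Ideals and maximal almost disjoint families -/

/-- The ideal `Fin × Fin` on `ℕ × ℕ`: a set belongs to it when all but finitely many of its
verticals `{m | (n, m) ∈ A}` are finite. -/
def finTwo : Set (Set (ℕ × ℕ)) :=
  {A | {n : ℕ | {m : ℕ | (n, m) ∈ A}.Infinite}.Finite}

/-- `𝒜` is an `I`-almost disjoint family: its members are not in `I`, and any two distinct
members have their intersection in `I`. -/
def IsADFamily {S : Type} (I : Set (Set S)) (𝒜 : Set (Set S)) : Prop :=
  (∀ A ∈ 𝒜, A ∉ I) ∧ ∀ A ∈ 𝒜, ∀ B ∈ 𝒜, A ≠ B → A ∩ B ∈ I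

/-- An `I`-mad family: an `I`-almost disjoint family that is not a proper subset of an
`I`-almost disjoint family. -/
def IsMadFamily {S : Type} (I : Set (Set S)) (𝒜 : Set (Set S)) : Prop :=
  IsADFamily I 𝒜 ∧ ∀ ℬ : Set (Set S), IsADFamily I ℬ → ¬ 𝒜 ⊂ ℬ

/-- `𝒜` is Dedekind infinite: there is an injection from `ℕ` into `𝒜`. -/
def DedekindInfinite {T : Type} (𝒜 : Set T) : Prop :=
  ∃ g : ℕ → 𝒜, Function.Injective g

/-! ### The spaces of subsets and of infinite subsets

The power set of a countable set `S` is topologised as the Cantor space `S → Bool`. -/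

/-- The subset of `S` with characteristic function `x`. -/
def toSet {S : Type} (x : S → Bool) : Set S := {s | x s = true}

/-- The space `[ℕ]^∞` of infinite subsets of `ℕ`, a subspace of the Cantor space. -/
abbrev InfSubset : Type := {x : ℕ → Bool // (toSet x).Infinite}

/-- The set `[A]^∞` of all infinite subsets of `A`. -/
def infSubsetsOf (A : InfSubset) : Set InfSubset := {B | toSet B.1 ⊆ toSet A.1}

/-- The Ramsey property of a set `P ⊆ [ℕ]^∞`. -/
def IsRamsey (P : Set InfSubset) : Prop :=
  ∃ A : InfSubset, infSubsetsOf A ⊆ P ∨ infSubsetsOf A ⊆ Pᶜ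

/-! ### Pointclasses -/

/-- A class of subsets of topological spaces. Only its values at Polish spaces matter; every
Polish space is homeomorphic to one in `Type`. -/
abbrev SetClass : Type 1 := ∀ (X : Type) [TopologicalSpace X], Set (Set X)

/-- A pointclass: a class of subsets of Polish spaces that is closed under continuous preimages
and under (binary) intersections and contains the Borel sets. -/
structure IsPointclass (Γ : SetClass) : Prop where
  preimage : ∀ (X Y : Type) [TopologicalSpace X] [PolishSpace X]
    [TopologicalSpace Y] [PolishSpace Y] (g : X → Y), Continuous g →
    ∀ s ∈ Γ Y, g ⁻¹' s ∈ Γ X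
  inter : ∀ (X : Type) [TopologicalSpace X] [PolishSpace X],
    ∀ s ∈ Γ X, ∀ t ∈ Γ X, s ∩ t ∈ Γ X
  borel : ∀ (X : Type) [TopologicalSpace X] [PolishSpace X] (s : Set X),
    @MeasurableSet X (borel X) s → s ∈ Γ X

/-- Closure under projections along Polish spaces. -/
def ClosedUnderProjection (Γ : SetClass) : Prop :=
  ∀ (X Y : Type) [TopologicalSpace X] [PolishSpace X] [TopologicalSpace Y] [PolishSpace Y],
    ∀ t ∈ Γ (X × Y), Prod.fst '' t ∈ Γ X

/-- All sets. -/
def allSets : SetClass := fun _ _ => Set.univ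

/-- `sigmaOne n` is the boldface class `Σ¹_{n+1}`: the analytic sets for `n = 0`, then the
projections along the Baire space of complements of sets of the preceding class. -/
def sigmaOne : ℕ → SetClass
  | 0 => fun _ _ => {s | MeasureTheory.AnalyticSet s}
  | n + 1 => fun X _ =>
      {s | ∃ t : Set (X × (ℕ → ℕ)), tᶜ ∈ sigmaOne n (X × (ℕ → ℕ)) ∧ s = Prod.fst '' t}

/-- The (boldface) projective sets. -/
def projectiveSets : SetClass := fun X _ => {s | ∃ n : ℕ, s ∈ sigmaOne n X}

/-- Every set `P ⊆ [ℕ]^∞` in the class has the Ramsey property. -/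
def AllRamsey (Γ : SetClass) : Prop := ∀ P : Set InfSubset, P ∈ Γ InfSubset → IsRamsey P

/-- The family `𝒜` of subsets of `ℕ × ℕ` belongs to the class, as a subset of the Cantor space
of characteristic functions. -/
def FamilyIn (Γ : SetClass) (𝒜 : Set (Set (ℕ × ℕ))) : Prop :=
  {x : ℕ × ℕ → Bool | toSet x ∈ 𝒜} ∈ Γ (ℕ × ℕ → Bool)

/-! ### Uniformisation and choice -/

/-- `R` is a total relation on `[ℕ]^∞`. -/
def IsTotalRel (R : Set (InfSubset × InfSubset)) : Prop := ∀ x, ∃ y, (x, y) ∈ R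

/-- The function `f` with domain `[A]^∞` uniformises `R` on `[A]^∞`. -/
def Uniformises (R : Set (InfSubset × InfSubset)) (A : InfSubset)
    (f : infSubsetsOf A → InfSubset) : Prop :=
  ∀ x : infSubsetsOf A, ((x : InfSubset), f x) ∈ R

/-- `f` is `Γ`-measurable: preimages of open sets are in `Γ`. -/
def MeasurableFor (Γ : SetClass) {X Y : Type} [TopologicalSpace X] [TopologicalSpace Y]
    (f : X → Y) : Prop :=
  ∀ U : Set Y, IsOpen U → f ⁻¹' U ∈ Γ X

/-- Ramsey positive uniformisation for the total relations in `Γ`: each of them is uniformised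
on some `[A]^∞` by a function whose graph is in `Γ`. For `Γ = allSets` the function is
arbitrary. -/
def RUnif (Γ : SetClass) : Prop :=
  ∀ R : Set (InfSubset × InfSubset), R ∈ Γ (InfSubset × InfSubset) → IsTotalRel R →
    ∃ (A : InfSubset) (f : infSubsetsOf A → InfSubset), Uniformises R A f ∧
      Set.range (fun x : infSubsetsOf A => ((x : InfSubset), f x)) ∈ Γ (InfSubset × InfSubset)

/-- The principle of Dependent Choice. -/
def DependentChoice : Prop :=
  ∀ (X : Type) (r : X → X → Prop), Nonempty X → (∀ x, ∃ y, r x y) →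
    ∃ u : ℕ → X, ∀ n, r (u n) (u (n + 1))

end FinTwoMad

/-! Take distinct members `A k` of a mad family. `exists_isPointSystem` picks points `pt k l b` of
`A k`, infinitely many for each `(k, l)`, all in one column `c k l ≥ l` where `A k` has finite
intersection with each earlier `A n`. An infinite `z` codes the set `pointsOf pt z` of all `pt k l
b` with `k, l` consecutive in `z` and `b ∈ z`. This set is not in the ideal, so maximality yields a
member `y` of the family whose intersection with it is not in the ideal, and then `MeetsOften pt z
y`. Hence the relation "`y` is in the family and `MeetsOften pt z y`" is total.

Let `F` be a uniformising function. The Ramsey property and a fusion give an infinite `W` below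
which membership in `F z`, and activity of the pairs, are decided by initial segments of `z`
(`exists_decidedAt`, `exists_decidedAt_of_measurableFor`). Then `F` is constant on the infinite
subsets of `W` (`eq_of_decidedAt`): any two initial segments extend to sets `w, w'` with `F w ∩ F
w'` outside the ideal (`exists_extensions_inter_notMem_finTwo`), so `F w = F w'` by almost
disjointness, and the initial segments already decide any given point.

The constant value `y` differs from every `A n`, since `A n` is active for no pair `(k, l)` with `k
> n`. So `y ∩ A k` is in the ideal for every `k`, and a sparse `z ⊆ W`, each of whose elements is
chosen beyond the columns where `y` meets the previous `A k` infinitely often, fails `MeetsOften pt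
z y`. This is a contradiction (`IsPointSystem.false_of_decidedAt`).

For the second statement, projecting the graph makes the uniformising function measurable for `Γ`
itself, so `Γ' = Γ` works. -/

namespace FinTwoMad

open Filter

/-! ### Deciding predicates by initial segments -/

/-- Whether `Q` holds of an infinite subset of `W` depends only on its elements up to `m`. -/
def DecidedAt (W : Set ℕ) (m : ℕ) (Q : Set ℕ → Prop) : Prop :=
  ∀ z ⊆ W, z.Infinite → ∀ z' ⊆ W, z'.Infinite → z ∩ Iic m = z' ∩ Iic m → (Q z ↔ Q z')

theorem DecidedAt.mono {W W' : Set ℕ} {m : ℕ} {Q : Set ℕ → Prop} (h : DecidedAt W m Q)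
    (hW : W' ⊆ W) : DecidedAt W' m Q :=
  fun z hz hi z' hz' hi' e => h z (hz.trans hW) hi z' (hz'.trans hW) hi' e

/-- The predicate `v ↦ Q (s ∪ v)` is constant on the infinite subsets of `V`. -/
def ConstantOn (Q : Set ℕ → Prop) (s V : Set ℕ) : Prop :=
  (∀ v ⊆ V, v.Infinite → Q (s ∪ v)) ∨ ∀ v ⊆ V, v.Infinite → ¬ Q (s ∪ v)

theorem ConstantOn.mono {Q : Set ℕ → Prop} {s V V' : Set ℕ} (h : ConstantOn Q s V)
    (hV : V' ⊆ V) : ConstantOn Q s V' :=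
  h.imp (fun h v hv => h v (hv.trans hV)) (fun h v hv => h v (hv.trans hV))

theorem exists_constantOn_of_finset {ι : Type*} (Q : ι → Set ℕ → Prop) (W : Set ℕ)
    (hR : ∀ i, ∀ s ⊆ W, s.Finite → ∀ V ⊆ W, V.Infinite →
      ∃ V' ⊆ V, V'.Infinite ∧ ConstantOn (Q i) s V')
    (T : Finset (ι × Set ℕ)) (hT : ∀ p ∈ T, p.2 ⊆ W ∧ p.2.Finite)
    (V : Set ℕ) (hV : V ⊆ W) (hVi : V.Infinite) :
    ∃ V' ⊆ V, V'.Infinite ∧ ∀ p ∈ T, ConstantOn (Q p.1) p.2 V' := by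
  classical
  induction T using Finset.induction_on with
  | empty => exact ⟨V, Subset.rfl, hVi, by simp⟩
  | insert p T _ ih =>
    obtain ⟨V₁, h₁, hi₁, hc₁⟩ := ih fun q hq => hT q (Finset.mem_insert_of_mem hq)
    obtain ⟨V₂, h₂, hi₂, hc₂⟩ := hR p.1 p.2 (hT p (Finset.mem_insert_self _ _)).1
      (hT p (Finset.mem_insert_self _ _)).2 V₁ (h₁.trans hV) hi₁
    refine ⟨V₂, h₂.trans h₁, hi₂, fun q hq => ?_⟩
    rcases Finset.mem_insert.1 hq with rfl | hq
    · exact hc₂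
    · exact (hc₁ q hq).mono h₂

/-- Fusion: if below every infinite set each `Q i`, with any finite set adjoined, can be made
constant, then some infinite `W` decides at each of its members `m` all `Q i` with `i ∈ D m`. -/
theorem exists_decidedAt {ι : Type*} (Q : ι → Set ℕ → Prop) (D : ℕ → Finset ι) (W₀ : Set ℕ)
    (hW₀ : W₀.Infinite)
    (hR : ∀ i, ∀ s ⊆ W₀, s.Finite → ∀ V ⊆ W₀, V.Infinite →
      ∃ V' ⊆ V, V'.Infinite ∧ ConstantOn (Q i) s V') :
    ∃ W ⊆ W₀, W.Infinite ∧ ∀ m ∈ W, ∀ i ∈ D m, DecidedAt W m (Q i) := by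
  classical
  let X := {V : Set ℕ // V ⊆ W₀ ∧ V.Infinite}
  -- The minimum of `V` becomes the next element of `W`. All finite `s` up to it are treated at
  -- once, since an infinite subset of `W` may have any of them as its initial segment.
  have step : ∀ V : X, ∃ V' : X, V'.1 ⊆ V.1 ∩ Ioi (sInf V.1) ∧
      ∀ i ∈ D (sInf V.1), ∀ s ⊆ W₀ ∩ Iic (sInf V.1), ConstantOn (Q i) s V'.1 := by
    rintro ⟨V, hV, hVi⟩
    have hfin : (W₀ ∩ Iic (sInf V)).Finite := (finite_Iic _).subset inter_subset_right
    have hinf : (V ∩ Ioi (sInf V)).Infinite := by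
      rw [← compl_Iic, ← sdiff_eq]
      exact hVi.sdiff (finite_Iic _)
    obtain ⟨V', h₁, h₂, h₃⟩ := exists_constantOn_of_finset Q W₀ hR
      (D (sInf V) ×ˢ hfin.finite_subsets.toFinset)
      (fun p hp => by
        have : p.2 ⊆ W₀ ∩ Iic (sInf V) := by simpa using (Finset.mem_product.1 hp).2
        exact ⟨this.trans inter_subset_left, hfin.subset this⟩)
      _ (inter_subset_left.trans hV) hinf
    refine ⟨⟨V', h₁.trans (inter_subset_left.trans hV), h₂⟩, h₁, fun i hi s hs => ?_⟩
    exact h₃ (i, s) (Finset.mem_product.2 ⟨hi, by simpa using hs⟩)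
  choose φ hφ hφ' using step
  let V : ℕ → X := fun n => φ^[n] ⟨W₀, Subset.rfl, hW₀⟩
  have hsucc : ∀ n, V (n + 1) = φ (V n) := fun n => Function.iterate_succ_apply' φ n _
  let μ : ℕ → ℕ := fun n => sInf (V n).1
  have hμ : ∀ n, μ n ∈ (V n).1 := fun n => Nat.sInf_mem (V n).2.2.nonempty
  have hanti : Antitone fun n => (V n).1 := antitone_nat_of_succ_le fun n => by
    rw [hsucc]
    exact (hφ (V n)).trans inter_subset_left
  have hmono : StrictMono μ := strictMono_nat_of_lt_succ fun n => by
    have := hμ (n + 1)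
    rw [hsucc] at this
    exact (hφ (V n) this).2
  have hsub : range μ ⊆ W₀ := by
    rintro _ ⟨n, rfl⟩
    exact (V n).2.1 (hμ n)
  refine ⟨range μ, hsub, infinite_range_of_injective hmono.injective, ?_⟩
  rintro _ ⟨n, rfl⟩ i hi z hz hzi z' hz' hzi' e
  have hc := hφ' (V n) i hi (z ∩ Iic (μ n)) (inter_subset_inter_left _ (hz.trans hsub))
  rw [← hsucc] at hc
  have tail : ∀ y ⊆ range μ, y ∩ Ioi (μ n) ⊆ (V (n + 1)).1 := by
    rintro y hy x ⟨hx, hx'⟩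
    obtain ⟨k, rfl⟩ := hy hx
    exact hanti (Nat.succ_le_of_lt (hmono.lt_iff_lt.1 hx')) (hμ k)
  have hinf : ∀ y : Set ℕ, y.Infinite → (y ∩ Ioi (μ n)).Infinite := fun y hy => by
    rw [← compl_Iic, ← sdiff_eq]
    exact hy.sdiff (finite_Iic _)
  have split : ∀ y : Set ℕ, y ∩ Iic (μ n) ∪ y ∩ Ioi (μ n) = y := fun y => by
    rw [← inter_union_distrib_left, Iic_union_Ioi, inter_univ]
  rw [← split z, ← split z', ← e]
  rcases hc with hc | hc
  · exact iff_of_true (hc _ (tail z hz) (hinf z hzi)) (hc _ (tail z' hz') (hinf z' hzi'))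
  · exact iff_of_false (hc _ (tail z hz) (hinf z hzi)) (hc _ (tail z' hz') (hinf z' hzi'))

end FinTwoMad

namespace FinTwoMad

open Filter

/-! ### Invariance of a decided uniformisation -/

/-- `k < l` are consecutive elements of `z`. -/
def AdjacentIn (z : Set ℕ) (k l : ℕ) : Prop :=
  k ∈ z ∧ l ∈ z ∧ k < l ∧ ∀ j, k < j → j < l → j ∉ z

/-- Infinitely many points `p b` with `b ∈ z` belong to `y`. -/
def ActiveIn (p : ℕ → ℕ × ℕ) (z : Set ℕ) (y : Set (ℕ × ℕ)) : Prop :=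
  ∃ᶠ b in atTop, b ∈ z ∧ p b ∈ y

/-- Every infinite subset of `W` whose elements up to `m` are those of `t` satisfies `Q`. -/
def ForcesAt (W : Set ℕ) (m : ℕ) (t : Set ℕ) (Q : Set ℕ → Prop) : Prop :=
  ∀ z ⊆ W, z.Infinite → z ∩ Iic m = t → Q z

theorem DecidedAt.forcesAt {W : Set ℕ} {m : ℕ} {Q : Set ℕ → Prop} (h : DecidedAt W m Q)
    {z : Set ℕ} (hz : z ⊆ W) (hzi : z.Infinite) (hQ : Q z) : ForcesAt W m (z ∩ Iic m) Q :=
  fun z' hz' hzi' e => (h z hz hzi z' hz' hzi' e.symm).1 hQ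

theorem ForcesAt.mono {W : Set ℕ} {m m' : ℕ} {t t' : Set ℕ} {Q : Set ℕ → Prop}
    (h : ForcesAt W m t Q) (hm : m ≤ m') (ht : t' ∩ Iic m = t) : ForcesAt W m' t' Q :=
  fun z hz hzi e => h z hz hzi (by
    rw [← ht, ← e, inter_assoc, inter_eq_self_of_subset_right (Iic_subset_Iic.2 hm)])

theorem union_inter_Iic {s M : Set ℕ} {m : ℕ} (hs : s ⊆ Iic m) (hM : M ⊆ Ioi m) :
    (s ∪ M) ∩ Iic m = s := by
  ext x
  constructor
  · rintro ⟨hx | hx, hxm⟩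
    · exact hx
    · exact absurd (mem_Iic.1 hxm) (not_le.2 (mem_Ioi.1 (hM hx)))
  · exact fun hx => ⟨Or.inl hx, hs hx⟩

theorem inter_Iic_inter_Iic (z : Set ℕ) {m m' : ℕ} (h : m ≤ m') :
    z ∩ Iic m' ∩ Iic m = z ∩ Iic m := by
  rw [inter_assoc, inter_eq_self_of_subset_right (Iic_subset_Iic.2 h)]

/-! ### One-step extensions that serve two initial segments at once -/

section Extension

variable {W : Set ℕ} {pt : ℕ → ℕ → ℕ → ℕ × ℕ} {F : Set ℕ → Set (ℕ × ℕ)}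

/-- Some end extension of `s`, contained in `W ∩ [0, l]` and having `k` as an element, forces
the pair `(k, l)` to be active. -/
def ReachesPair (W : Set ℕ) (pt : ℕ → ℕ → ℕ → ℕ × ℕ) (F : Set ℕ → Set (ℕ × ℕ)) (m : ℕ)
    (s : Set ℕ) (k l : ℕ) : Prop :=
  ∃ t ⊆ W ∩ Iic l, t ∩ Iic m = s ∧ k ∈ t ∧ ForcesAt W l t fun z => ActiveIn (pt k l) z (F z)

/-- Some end extension of `s`, contained in `W ∩ [0, b]`, forces `q` to belong to `F z`. -/
def ReachesPoint (W : Set ℕ) (F : Set ℕ → Set (ℕ × ℕ)) (m : ℕ) (s : Set ℕ) (q : ℕ × ℕ)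
    (b : ℕ) : Prop :=
  ∃ t ⊆ W ∩ Iic b, t ∩ Iic m = s ∧ ForcesAt W b t fun z => q ∈ F z

/-- Apply `hact` to `s ∪ M`. An active pair above `m` is consecutive in `M`, and its activity, being
decided at `l`, is forced by the part of `s ∪ M` up to `l`. -/
theorem exists_adjacentIn_reachesPair
    (hdec : ∀ m ∈ W, ∀ k ≤ m, ∀ l ≤ m, DecidedAt W m fun z => ActiveIn (pt k l) z (F z))
    (hact : ∀ z ⊆ W, z.Infinite →
      ∃ᶠ k in atTop, ∃ l, AdjacentIn z k l ∧ ActiveIn (pt k l) z (F z))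
    {m : ℕ} {s : Set ℕ} (hs : s ⊆ W ∩ Iic m) {M : Set ℕ} (hM : M ⊆ W ∩ Ioi m)
    (hMi : M.Infinite) (N : ℕ) :
    ∃ k l, N ≤ k ∧ AdjacentIn M k l ∧ ReachesPair W pt F m s k l := by
  have hzW : s ∪ M ⊆ W := union_subset (hs.trans inter_subset_left) (hM.trans inter_subset_left)
  have hzi : (s ∪ M).Infinite := hMi.mono subset_union_right
  have hcut : (s ∪ M) ∩ Iic m = s :=
    union_inter_Iic (hs.trans inter_subset_right) (hM.trans inter_subset_right)
  obtain ⟨k, hk, l, ⟨hkz, hlz, hkl, hno⟩, hA⟩ :=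
    frequently_atTop.1 (hact _ hzW hzi) (max N (m + 1))
  have hNk : N ≤ k := (le_max_left _ _).trans hk
  have hmk : m < k := (le_max_right N (m + 1)).trans hk
  have inM : ∀ x ∈ s ∪ M, m < x → x ∈ M := fun x hx hmx =>
    hx.resolve_left fun h => absurd (hs h).2 (not_le.2 hmx)
  refine ⟨k, l, hNk, ⟨inM k hkz hmk, inM l hlz (hmk.trans hkl), hkl,
    fun j h₁ h₂ h₃ => hno j h₁ h₂ (Or.inr h₃)⟩, (s ∪ M) ∩ Iic l,
    inter_subset_inter_left _ hzW, ?_, ⟨hkz, hkl.le⟩,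
    (hdec l (hzW hlz) k hkl.le l le_rfl).forcesAt hzW hzi hA⟩
  rw [inter_Iic_inter_Iic _ (hmk.trans hkl).le, hcut]

/-- Ramsey's theorem for pairs yields an infinite `M` where either every consecutive pair is reached
from `s`, or no pair is. The preceding lemma for `s` and `M` excludes the second case; in the first
case the same lemma for `s'` and `M` gives a consecutive pair, which both reach. -/
theorem exists_reachesPair_both (hW : W.Infinite)
    (hdec : ∀ m ∈ W, ∀ k ≤ m, ∀ l ≤ m, DecidedAt W m fun z => ActiveIn (pt k l) z (F z))
    (hact : ∀ z ⊆ W, z.Infinite →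
      ∃ᶠ k in atTop, ∃ l, AdjacentIn z k l ∧ ActiveIn (pt k l) z (F z))
    {m : ℕ} {s s' : Set ℕ} (hs : s ⊆ W ∩ Iic m) (hs' : s' ⊆ W ∩ Iic m) (N : ℕ) :
    ∃ k l, N ≤ k ∧ k < l ∧ m < k ∧ l ∈ W ∧
      ReachesPair W pt F m s k l ∧ ReachesPair W pt F m s' k l := by
  have hinf : (W ∩ Ioi m).Infinite := by
    rw [← compl_Iic, ← sdiff_eq]
    exact hW.sdiff (finite_Iic _)
  let f : ℕ → ℕ := Nat.nth (· ∈ W ∩ Ioi m)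
  have hf : StrictMono f := Nat.nth_strictMono hinf
  have hfW : ∀ n, f n ∈ W ∩ Ioi m := Nat.nth_mem_of_infinite hinf
  obtain ⟨g, hg⟩ := exists_increasing_or_nonincreasing_subseq' (ReachesPair W pt F m s) f
  have hfg : StrictMono fun n => f (g n) := hf.comp g.strictMono
  have hMi : (range fun n => f (g n)).Infinite := infinite_range_of_injective hfg.injective
  have hM : (range fun n => f (g n)) ⊆ W ∩ Ioi m := by
    rintro _ ⟨n, rfl⟩
    exact hfW _
  rcases hg with hg | hg
  · obtain ⟨k, l, hNk, ⟨hk, hl, hkl, hno⟩, hr⟩ :=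
      exists_adjacentIn_reachesPair hdec hact hs' hM hMi N
    obtain ⟨i, rfl⟩ := hk
    obtain ⟨j, rfl⟩ := hl
    have hij : i < j := hfg.lt_iff_lt.1 hkl
    have hj : j = i + 1 := by
      by_contra hne
      exact hno (f (g (i + 1))) (hfg (Nat.lt_succ_self i)) (hfg (by omega)) ⟨i + 1, rfl⟩
    subst hj
    exact ⟨_, _, hNk, hkl, (hfW _).2, (hfW _).1, hg i, hr⟩
  · obtain ⟨k, l, hNk, ⟨hk, hl, hkl, hno⟩, hr⟩ :=
      exists_adjacentIn_reachesPair hdec hact hs hM hMi N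
    obtain ⟨i, rfl⟩ := hk
    obtain ⟨j, rfl⟩ := hl
    exact absurd hr (hg i j (hfg.lt_iff_lt.1 hkl))

/-- If the exceptional `b` formed an infinite set `M`, then activity for `s ∪ M` would give some `b
∈ M` with `p b ∈ F (s ∪ M)`, and the part of `s ∪ M` up to `b` would force this. The clause `b ∈ z`
in `ActiveIn` is what puts `b` in `M`. -/
theorem finite_not_reachesPoint {p : ℕ → ℕ × ℕ} {m : ℕ}
    (hdec : ∀ b ∈ W, m ≤ b → DecidedAt W b fun z => p b ∈ F z)
    {s : Set ℕ} (hs : s ⊆ W ∩ Iic m) (hA : ForcesAt W m s fun z => ActiveIn p z (F z)) :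
    {b ∈ W ∩ Ioi m | ¬ ReachesPoint W F m s (p b) b}.Finite := by
  by_contra hMi
  set M := {b ∈ W ∩ Ioi m | ¬ ReachesPoint W F m s (p b) b} with hMdef
  have hM : M ⊆ W ∩ Ioi m := fun b hb => hb.1
  have hzW : s ∪ M ⊆ W := union_subset (hs.trans inter_subset_left) (hM.trans inter_subset_left)
  have hzi : (s ∪ M).Infinite := Set.Infinite.mono subset_union_right hMi
  have hcut : (s ∪ M) ∩ Iic m = s :=
    union_inter_Iic (hs.trans inter_subset_right) (hM.trans inter_subset_right)
  obtain ⟨b, hb, hbz, hbF⟩ := frequently_atTop.1 (hA _ hzW hzi hcut) (m + 1)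
  have hmb : m < b := hb
  have hbM : b ∈ M := hbz.resolve_left fun h => absurd (hs h).2 (not_le.2 hmb)
  refine hbM.2 ⟨(s ∪ M) ∩ Iic b, inter_subset_inter_left _ hzW, ?_,
    (hdec b (hzW hbz) hmb.le).forcesAt hzW hzi hbF⟩
  rw [inter_Iic_inter_Iic _ hmb.le, hcut]

theorem exists_reachesPoint_both (hW : W.Infinite) {p : ℕ → ℕ × ℕ} {m : ℕ}
    (hdec : ∀ b ∈ W, m ≤ b → DecidedAt W b fun z => p b ∈ F z)
    {s s' : Set ℕ} (hs : s ⊆ W ∩ Iic m) (hs' : s' ⊆ W ∩ Iic m)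
    (hA : ForcesAt W m s fun z => ActiveIn p z (F z))
    (hA' : ForcesAt W m s' fun z => ActiveIn p z (F z)) (N : ℕ) :
    ∃ b ∈ W, N ≤ b ∧ m < b ∧ ReachesPoint W F m s (p b) b ∧ ReachesPoint W F m s' (p b) b := by
  obtain ⟨b, hbW, hb⟩ := (hW.sdiff (((finite_not_reachesPoint hdec hs hA).union
    (finite_not_reachesPoint hdec hs' hA')).union (finite_Iic (max N m)))).nonempty
  simp only [mem_union, mem_ofPred_eq, mem_inter_iff, mem_Ioi, mem_Iic, not_or, not_and, not_not,
    not_le, max_lt_iff] at hb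
  exact ⟨b, hbW, hb.2.1.le, hb.2.2, hb.1.1 ⟨hbW, hb.2.2⟩, hb.1.2 ⟨hbW, hb.2.2⟩⟩

end Extension

/-- Two finite subsets of `W ∩ [0, top]` with `top ∈ W`, regarded as approximations to two
infinite subsets of `W`. -/
structure Approx (W : Set ℕ) where
  top : ℕ
  fst : Set ℕ
  snd : Set ℕ
  top_mem : top ∈ W
  fst_subset : fst ⊆ W ∩ Iic top
  snd_subset : snd ⊆ W ∩ Iic top

instance (W : Set ℕ) : Preorder (Approx W) where
  le σ τ := σ.top ≤ τ.top ∧ τ.fst ∩ Iic σ.top = σ.fst ∧ τ.snd ∩ Iic σ.top = σ.snd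
  le_refl σ := ⟨le_rfl, inter_eq_self_of_subset_left (σ.fst_subset.trans inter_subset_right),
    inter_eq_self_of_subset_left (σ.snd_subset.trans inter_subset_right)⟩
  le_trans σ τ υ h h' := ⟨h.1.trans h'.1,
    by rw [← h.2.1, ← h'.2.1, inter_Iic_inter_Iic _ h.1],
    by rw [← h.2.2, ← h'.2.2, inter_Iic_inter_Iic _ h.1]⟩

namespace Approx

variable {W : Set ℕ}

/-- Both components force `Q`. -/
def Forces (σ : Approx W) (Q : Set ℕ → Prop) : Prop :=
  ForcesAt W σ.top σ.fst Q ∧ ForcesAt W σ.top σ.snd Q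

theorem Forces.mono {σ τ : Approx W} {Q : Set ℕ → Prop} (h : σ.Forces Q) (hle : σ ≤ τ) :
    τ.Forces Q :=
  ⟨h.1.mono hle.1 hle.2.1, h.2.mono hle.1 hle.2.2⟩

end Approx

/-! ### Generic pairs of infinite sets, and constancy of the uniformisation -/

section Invariance

variable {W : Set ℕ} {pt : ℕ → ℕ → ℕ → ℕ × ℕ} {F : Set ℕ → Set (ℕ × ℕ)}

/-- The approximations that force some pair beyond `N` to be active. -/
def pairCofinal (hW : W.Infinite)
    (hdec : ∀ m ∈ W, ∀ k ≤ m, ∀ l ≤ m, DecidedAt W m fun z => ActiveIn (pt k l) z (F z))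
    (hact : ∀ z ⊆ W, z.Infinite →
      ∃ᶠ k in atTop, ∃ l, AdjacentIn z k l ∧ ActiveIn (pt k l) z (F z))
    (N : ℕ) : Order.Cofinal (Approx W) where
  carrier := {σ | ∃ k l, N ≤ k ∧ k < l ∧ l ≤ σ.top ∧ k ∈ σ.fst ∧ k ∈ σ.snd ∧
    σ.Forces fun z => ActiveIn (pt k l) z (F z)}
  isCofinal σ := by
    obtain ⟨k, l, hN, hkl, hmk, hl, ⟨t, ht, hts, hkt, hF⟩, ⟨t', ht', hts', hkt', hF'⟩⟩ :=
      exists_reachesPair_both hW hdec hact σ.fst_subset σ.snd_subset N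
    exact ⟨⟨l, t, t', hl, ht, ht'⟩, ⟨k, l, hN, hkl, le_rfl, hkt, hkt', hF, hF'⟩,
      (hmk.trans hkl).le, hts, hts'⟩

/-- The approximations that force some `pt k l b` with `b ≥ N` to belong to `F z`, or have no
extension forcing the pair `(k, l)` to be active. -/
def pointCofinal (hW : W.Infinite)
    (hdec : ∀ m ∈ W, ∀ k ≤ m, ∀ l ≤ m, DecidedAt W m fun z => pt k l m ∈ F z)
    (k l N : ℕ) : Order.Cofinal (Approx W) where
  carrier := {σ | (∃ b ≥ N, σ.Forces fun z => pt k l b ∈ F z) ∨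
    ∀ τ ≥ σ, k ≤ τ.top → l ≤ τ.top → ¬ τ.Forces fun z => ActiveIn (pt k l) z (F z)}
  isCofinal σ := by
    by_cases h : ∀ τ ≥ σ, k ≤ τ.top → l ≤ τ.top →
        ¬ τ.Forces fun z => ActiveIn (pt k l) z (F z)
    · exact ⟨σ, Or.inr h, le_rfl⟩
    · push Not at h
      obtain ⟨τ, hτ, hk, hl, hF⟩ := h
      obtain ⟨b, hbW, hN, hb, ⟨t, ht, hts, hp⟩, ⟨t', ht', hts', hp'⟩⟩ :=
        exists_reachesPoint_both hW (p := pt k l)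
          (fun b hb hmb => hdec b hb k (hk.trans hmb) l (hl.trans hmb))
          τ.fst_subset τ.snd_subset hF.1 hF.2 N
      exact ⟨⟨b, t, t', hbW, ht, ht'⟩, Or.inl ⟨b, hN, hp, hp'⟩,
        hτ.trans ⟨hb.le, hts, hts'⟩⟩

theorem iUnion_inter_Iic {s : ℕ → Set ℕ} {m : ℕ → ℕ}
    (hs : ∀ n, s n ⊆ Iic (m n)) (h : ∀ i j, i ≤ j → s j ∩ Iic (m i) = s i) (n : ℕ) :
    (⋃ i, s i) ∩ Iic (m n) = s n := by
  ext x
  simp only [mem_inter_iff, mem_iUnion]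
  constructor
  · rintro ⟨⟨i, hi⟩, hx⟩
    rcases le_total i n with hin | hin
    · rw [← h i n hin] at hi
      exact hi.1
    · rw [← h n i hin]
      exact ⟨hi, hx⟩
  · exact fun hx => ⟨⟨n, hx⟩, hs n hx⟩

/-- The infinite columns found lie at `c k l ≥ l ≥ N`, hence are unbounded. -/
theorem notMem_finTwo_of_active {y : Set (ℕ × ℕ)} {c : ℕ → ℕ → ℕ}
    (hpt : ∀ k l, Function.Injective (pt k l)) (hcol : ∀ k l b, (pt k l b).1 = c k l)
    (hc : ∀ k l, l ≤ c k l)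
    (h : ∀ N, ∃ k l, N ≤ l ∧ ∃ᶠ b in atTop, pt k l b ∈ y) : y ∉ finTwo := by
  refine Set.infinite_of_forall_exists_gt fun N => ?_
  obtain ⟨k, l, hl, hb⟩ := h (N + 1)
  refine ⟨c k l, ?_, lt_of_lt_of_le hl (hc k l)⟩
  have hinf : {b | pt k l b ∈ y}.Infinite := Nat.frequently_atTop_iff_infinite.1 hb
  refine Set.Infinite.mono ?_ (hinf.image (f := fun b => (pt k l b).2) ?_)
  · rintro _ ⟨b, hb, rfl⟩
    change (c k l, (pt k l b).2) ∈ y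
    rw [← hcol k l b]
    exact hb
  · exact fun b _ b' _ e => hpt k l (Prod.ext (by rw [hcol, hcol]) e)

/-- Starting from any approximation there are two infinite sets extending it on which the values
of `F` have large intersection. -/
theorem exists_extensions_inter_notMem_finTwo (hW : W.Infinite) {c : ℕ → ℕ → ℕ}
    (hpt : ∀ k l, Function.Injective (pt k l)) (hcol : ∀ k l b, (pt k l b).1 = c k l)
    (hc : ∀ k l, l ≤ c k l)
    (hdec : ∀ m ∈ W, ∀ k ≤ m, ∀ l ≤ m, DecidedAt W m fun z => ActiveIn (pt k l) z (F z))
    (hdec' : ∀ m ∈ W, ∀ k ≤ m, ∀ l ≤ m, DecidedAt W m fun z => pt k l m ∈ F z)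
    (hact : ∀ z ⊆ W, z.Infinite →
      ∃ᶠ k in atTop, ∃ l, AdjacentIn z k l ∧ ActiveIn (pt k l) z (F z))
    (σ : Approx W) :
    ∃ z ⊆ W, ∃ z' ⊆ W, z.Infinite ∧ z'.Infinite ∧ z ∩ Iic σ.top = σ.fst ∧
      z' ∩ Iic σ.top = σ.snd ∧ F z ∩ F z' ∉ finTwo := by
  -- A sequence meeting these countably many cofinal sets is generic: its unions are infinite, share
  -- active pairs with arbitrarily large `k`, and for each such pair have infinitely many points
  -- common to both values of `F`.
  let 𝒟 : ℕ ⊕ ℕ × ℕ × ℕ → Order.Cofinal (Approx W) :=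
    Sum.elim (pairCofinal hW hdec hact) fun p => pointCofinal hW hdec' p.1 p.2.1 p.2.2
  let u := Order.sequenceOfCofinals σ 𝒟
  have hu : Monotone u := Order.sequenceOfCofinals.monotone σ 𝒟
  have hmeet : ∀ i, ∃ n, u n ∈ 𝒟 i :=
    fun i => ⟨_, Order.sequenceOfCofinals.encode_mem σ 𝒟 i⟩
  have hz : ∀ n, (⋃ i, (u i).fst) ∩ Iic (u n).top = (u n).fst :=
    iUnion_inter_Iic (m := fun n => (u n).top) (fun n => (u n).fst_subset.trans inter_subset_right)
      fun i j h => (hu h).2.1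
  have hz' : ∀ n, (⋃ i, (u i).snd) ∩ Iic (u n).top = (u n).snd :=
    iUnion_inter_Iic (m := fun n => (u n).top) (fun n => (u n).snd_subset.trans inter_subset_right)
      fun i j h => (hu h).2.2
  have hpair : ∀ N, ∃ n k l, N ≤ k ∧ k < l ∧ l ≤ (u n).top ∧ k ∈ (u n).fst ∧ k ∈ (u n).snd ∧
      (u n).Forces fun z => ActiveIn (pt k l) z (F z) := fun N => hmeet (Sum.inl N)
  have hzi : (⋃ i, (u i).fst).Infinite := Set.infinite_of_forall_exists_gt fun N => by
    obtain ⟨n, k, l, hk, -, -, h, -⟩ := hpair (N + 1)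
    exact ⟨k, mem_iUnion.2 ⟨n, h⟩, hk⟩
  have hzi' : (⋃ i, (u i).snd).Infinite := Set.infinite_of_forall_exists_gt fun N => by
    obtain ⟨n, k, l, hk, -, -, -, h, -⟩ := hpair (N + 1)
    exact ⟨k, mem_iUnion.2 ⟨n, h⟩, hk⟩
  have hzW : (⋃ i, (u i).fst) ⊆ W :=
    iUnion_subset fun i => (u i).fst_subset.trans inter_subset_left
  have hzW' : (⋃ i, (u i).snd) ⊆ W :=
    iUnion_subset fun i => (u i).snd_subset.trans inter_subset_left
  refine ⟨_, hzW, _, hzW', hzi, hzi', hz 0, hz' 0, ?_⟩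
  refine notMem_finTwo_of_active hpt hcol hc fun N => ?_
  obtain ⟨n, k, l, hN, hkl, hl, -, -, hF⟩ := hpair N
  refine ⟨k, l, hN.trans hkl.le, frequently_atTop.2 fun B => ?_⟩
  obtain ⟨j, hj⟩ := hmeet (Sum.inr (k, l, B))
  rcases hj with ⟨b, hb, h⟩ | h
  · exact ⟨b, hb, h.1 _ hzW hzi (hz j), h.2 _ hzW' hzi' (hz' j)⟩
  -- A later stage of the sequence extends both `u n`, which forces activity, and `u j`, none of
  -- whose extensions does.
  · exact absurd (hF.mono (hu (le_max_left n j))) (h (u (max n j)) (hu (le_max_right n j))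
      ((hkl.le.trans hl).trans (hu (le_max_left n j)).1) (hl.trans (hu (le_max_left n j)).1))

theorem eq_of_decidedAt (hW : W.Infinite) {c : ℕ → ℕ → ℕ}
    (hpt : ∀ k l, Function.Injective (pt k l)) (hcol : ∀ k l b, (pt k l b).1 = c k l)
    (hc : ∀ k l, l ≤ c k l)
    (hdec : ∀ m ∈ W, ∀ k ≤ m, ∀ l ≤ m, DecidedAt W m fun z => ActiveIn (pt k l) z (F z))
    (hdec' : ∀ m ∈ W, ∀ k ≤ m, ∀ l ≤ m, DecidedAt W m fun z => pt k l m ∈ F z)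
    (hdec₂ : ∀ m ∈ W, ∀ i ≤ m, ∀ j ≤ m, DecidedAt W m fun z => (i, j) ∈ F z)
    (hact : ∀ z ⊆ W, z.Infinite →
      ∃ᶠ k in atTop, ∃ l, AdjacentIn z k l ∧ ActiveIn (pt k l) z (F z))
    (hAD : ∀ z ⊆ W, z.Infinite → ∀ z' ⊆ W, z'.Infinite → F z ∩ F z' ∉ finTwo → F z = F z')
    {z z' : Set ℕ} (hz : z ⊆ W) (hzi : z.Infinite) (hz' : z' ⊆ W) (hzi' : z'.Infinite) :
    F z = F z' := by
  ext ⟨i, j⟩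
  obtain ⟨m, hmW, hm⟩ := hW.exists_gt (max i j)
  have hi : i ≤ m := (le_max_left i j).trans hm.le
  have hj : j ≤ m := (le_max_right i j).trans hm.le
  obtain ⟨w, hw, w', hw', hwi, hwi', e, e', hF⟩ :=
    exists_extensions_inter_notMem_finTwo hW hpt hcol hc hdec hdec' hact
      ⟨m, z ∩ Iic m, z' ∩ Iic m, hmW, inter_subset_inter_left _ hz, inter_subset_inter_left _ hz'⟩
  have h : (i, j) ∈ F z ↔ (i, j) ∈ F w := hdec₂ m hmW i hi j hj z hz hzi w hw hwi e.symm
  rw [hAD w hw hwi w' hw' hwi' hF] at h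
  exact h.trans (hdec₂ m hmW i hi j hj z' hz' hzi' w' hw' hwi' e'.symm).symm

end Invariance

end FinTwoMad

namespace FinTwoMad

open Filter

/-! ### Points of an almost disjoint sequence -/

theorem IsMadFamily.exists_inter_notMem {S : Type} {I 𝒜 : Set (Set S)} (h : IsMadFamily I 𝒜)
    {B : Set S} (hB : B ∉ I) : ∃ y ∈ 𝒜, y ∩ B ∉ I := by
  by_contra! hcon
  have hB𝒜 : B ∉ 𝒜 := fun hmem => hB (by simpa using hcon B hmem)
  refine h.2 (insert B 𝒜) ⟨?_, ?_⟩ (ssubset_insert hB𝒜)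
  · rintro A (rfl | hA)
    · exact hB
    · exact h.1.1 A hA
  · rintro A (rfl | hA) A' (rfl | hA') hne
    · exact absurd rfl hne
    · rw [inter_comm]
      exact hcon A' hA'
    · exact hcon A hA
    · exact h.1.2 A hA A' hA' hne

/-- The points `pt k l b` are distinct points of `A k` in a vertical `c k l ≥ l`, on which `A k`
is almost disjoint from each `A n` with `n < k`. -/
structure IsPointSystem (A : ℕ → Set (ℕ × ℕ)) (pt : ℕ → ℕ → ℕ → ℕ × ℕ) (c : ℕ → ℕ → ℕ) :
    Prop where
  injective : ∀ k l, Function.Injective (pt k l)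
  col : ∀ k l b, (pt k l b).1 = c k l
  le_col : ∀ k l, l ≤ c k l
  mem : ∀ k l b, pt k l b ∈ A k
  not_frequently : ∀ k l n, n < k → ¬ ∃ᶠ b in atTop, pt k l b ∈ A n

theorem finite_column_of_not_frequently {p : ℕ → ℕ × ℕ} (hp : Function.Injective p) {i : ℕ}
    (hi : ∀ b, (p b).1 = i) {y : Set (ℕ × ℕ)} (hy : {m | (i, m) ∈ y}.Finite) :
    ¬ ∃ᶠ b in atTop, p b ∈ y := by
  rw [Nat.frequently_atTop_iff_infinite, not_infinite]
  refine Set.Finite.subset (hy.preimage (f := fun b => (p b).2) ?_) fun b hb => ?_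
  · exact fun b _ b' _ e => hp (Prod.ext (by rw [hi, hi]) e)
  · change (i, (p b).2) ∈ y
    rw [← hi b]
    exact hb

/-- `A k` has infinitely many infinite columns, and only finitely many columns meet `A k ∩ A n`
infinitely often for some `n < k`. A good column therefore exists beyond any `l`. -/
theorem exists_isPointSystem {A : ℕ → Set (ℕ × ℕ)} (hA : ∀ k, A k ∉ finTwo)
    (hAD : ∀ n k, n ≠ k → A k ∩ A n ∈ finTwo) : ∃ pt c, IsPointSystem A pt c := by
  have hc : ∀ k l, ∃ c, l ≤ c ∧ {m | (c, m) ∈ A k}.Infinite ∧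
      ∀ n < k, {m | (c, m) ∈ A k ∩ A n}.Finite := by
    intro k l
    have hfin : (⋃ n ∈ Iio k, {c | {m | (c, m) ∈ A k ∩ A n}.Infinite}).Finite :=
      (finite_Iio k).biUnion fun n hn => hAD n k (ne_of_lt hn)
    have hinf : {c | {m | (c, m) ∈ A k}.Infinite}.Infinite := hA k
    obtain ⟨c, hc, hlc⟩ := (hinf.sdiff hfin).exists_gt l
    refine ⟨c, hlc.le, hc.1, fun n hn => ?_⟩
    by_contra hcon
    exact hc.2 (mem_biUnion (show n ∈ Iio k from hn) hcon)
  choose c hlc hinf hfin using hc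
  have hmem : ∀ k l b, (c k l, Nat.nth (fun m => (c k l, m) ∈ A k) b) ∈ A k :=
    fun k l b => Nat.nth_mem_of_infinite (p := fun m => (c k l, m) ∈ A k) (hinf k l) b
  have hinj : ∀ k l, Function.Injective fun b =>
      (c k l, Nat.nth (fun m => (c k l, m) ∈ A k) b) :=
    fun k l b b' e => Nat.nth_injective (hinf k l) (Prod.ext_iff.1 e).2
  refine ⟨fun k l b => (c k l, Nat.nth (fun m => (c k l, m) ∈ A k) b), c, hinj,
    fun _ _ _ => rfl, hlc, hmem, fun k l n hn hfr => ?_⟩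
  exact finite_column_of_not_frequently (hinj k l) (fun _ => rfl) (hfin k l n hn)
    (hfr.mono fun b hb => ⟨hmem k l b, hb⟩)

theorem AdjacentIn.unique {z : Set ℕ} {k l l' : ℕ} (h : AdjacentIn z k l)
    (h' : AdjacentIn z k l') : l = l' := by
  rcases lt_trichotomy l l' with hlt | heq | hlt
  · exact absurd h.2.1 (h'.2.2.2 l h.2.2.1 hlt)
  · exact heq
  · exact absurd h'.2.1 (h.2.2.2 l' h'.2.2.1 hlt)

theorem exists_adjacentIn {z : Set ℕ} (hz : z.Infinite) {k : ℕ} (hk : k ∈ z) :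
    ∃ l, AdjacentIn z k l := by
  classical
  have h : ∃ l, l ∈ z ∧ k < l := hz.exists_gt k
  exact ⟨Nat.find h, hk, (Nat.find_spec h).1, (Nat.find_spec h).2,
    fun j hkj hj hjz => Nat.find_min h hj ⟨hjz, hkj⟩⟩

/-- Infinitely many consecutive pairs `(k, l)` of `z` are active for `y`. -/
def MeetsOften (pt : ℕ → ℕ → ℕ → ℕ × ℕ) (z : Set ℕ) (y : Set (ℕ × ℕ)) : Prop :=
  ∃ᶠ k in atTop, ∃ l, AdjacentIn z k l ∧ ActiveIn (pt k l) z y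

variable {A : ℕ → Set (ℕ × ℕ)} {pt : ℕ → ℕ → ℕ → ℕ × ℕ} {c : ℕ → ℕ → ℕ}

/-- The points `pt k l b` with `b ∈ z` for the consecutive pairs `(k, l)` of `z`. -/
def pointsOf (pt : ℕ → ℕ → ℕ → ℕ × ℕ) (z : Set ℕ) : Set (ℕ × ℕ) :=
  {q | ∃ k l b, AdjacentIn z k l ∧ b ∈ z ∧ pt k l b = q}

theorem IsPointSystem.pointsOf_notMem_finTwo (h : IsPointSystem A pt c) {z : Set ℕ}
    (hz : z.Infinite) : pointsOf pt z ∉ finTwo := by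
  refine notMem_finTwo_of_active h.injective h.col h.le_col fun N => ?_
  obtain ⟨k, hk, hNk⟩ := hz.exists_gt N
  obtain ⟨l, hl⟩ := exists_adjacentIn hz hk
  refine ⟨k, l, (hNk.trans hl.2.2.1).le, ?_⟩
  exact (Nat.frequently_atTop_iff_infinite.2 hz).mono fun b hb => ⟨k, l, b, hl, hb, rfl⟩

/-- Since `k < l ≤ c k l`, only finitely many pairs contribute to a given column, so an infinite
column of the intersection contains an active pair. Each `k` has at most one successor in `z`, so
infinitely many columns require infinitely many `k`. -/
theorem IsPointSystem.meetsOften (h : IsPointSystem A pt c) {z : Set ℕ} {y : Set (ℕ × ℕ)}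
    (hy : y ∩ pointsOf pt z ∉ finTwo) : MeetsOften pt z y := by
  have hcols : ∀ i, {m | (i, m) ∈ y ∩ pointsOf pt z}.Infinite →
      ∃ k l, AdjacentIn z k l ∧ c k l = i ∧ ActiveIn (pt k l) z y := by
    intro i hi
    by_contra! hcon
    refine hi (Set.Finite.subset (((finite_Iic i).prod (finite_Iic i)).biUnion
      (t := fun p : ℕ × ℕ => {m | AdjacentIn z p.1 p.2 ∧
        ∃ b ∈ z, pt p.1 p.2 b = (i, m) ∧ pt p.1 p.2 b ∈ y}) ?_) ?_)
    · rintro ⟨k, l⟩ -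
      by_cases had : AdjacentIn z k l ∧ c k l = i
      · have hfin := hcon k l had.1 had.2
        rw [ActiveIn, Nat.frequently_atTop_iff_infinite, not_infinite] at hfin
        refine (hfin.image fun b => (pt k l b).2).subset ?_
        rintro m ⟨-, b, hb, e, hby⟩
        exact ⟨b, ⟨hb, hby⟩, by simp only [e]⟩
      · refine Set.Finite.subset finite_empty ?_
        rintro m ⟨h₁, b, -, e, -⟩
        exact had ⟨h₁, by rw [← h.col k l b, e]⟩
    · rintro m ⟨hmy, k, l, b, had, hb, e⟩
      have hli : l ≤ i := (h.le_col k l).trans (by rw [← h.col k l b, e])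
      exact mem_biUnion (show (k, l) ∈ Iic i ×ˢ Iic i from ⟨had.2.2.1.le.trans hli, hli⟩)
        ⟨had, b, hb, e, e ▸ hmy⟩
  refine frequently_atTop.2 fun N => ?_
  by_contra! hcon
  refine hy (Set.Finite.subset ((finite_Iio N).biUnion
    (t := fun k => {i | ∃ l, AdjacentIn z k l ∧ c k l = i}) ?_) ?_)
  · intro k _
    refine Set.Subsingleton.finite ?_
    rintro _ ⟨l, hl, rfl⟩ _ ⟨l', hl', rfl⟩
    rw [hl.unique hl']
  · intro i hi
    obtain ⟨k, l, had, hc, hact⟩ := hcols i hi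
    have hk : k < N := by
      by_contra hk
      exact hcon k (not_lt.1 hk) l had hact
    exact mem_biUnion (show k ∈ Iio N from hk) ⟨l, had, hc⟩

theorem IsPointSystem.not_meetsOften_self (h : IsPointSystem A pt c) (z : Set ℕ) (n : ℕ) :
    ¬ MeetsOften pt z (A n) := by
  intro hm
  obtain ⟨k, hk, l, -, hact⟩ := frequently_atTop.1 hm (n + 1)
  exact h.not_frequently k l n hk (hact.mono fun b hb => hb.2)

/-- All columns where `y ∩ A k` is infinite lie below some `B k`. If each element `k` of `z` is
followed by one that is at least `B k`, no pair of `z` is active for `y`. -/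
theorem IsPointSystem.exists_not_meetsOften (h : IsPointSystem A pt c) {y : Set (ℕ × ℕ)}
    (hy : ∀ k, y ∩ A k ∈ finTwo) {W : Set ℕ} (hW : W.Infinite) :
    ∃ z ⊆ W, z.Infinite ∧ ¬ MeetsOften pt z y := by
  have hB : ∀ k, ∃ B, ∀ l, B ≤ l → ¬ ∃ᶠ b in atTop, pt k l b ∈ y := by
    intro k
    obtain ⟨B, hB⟩ := Set.Finite.bddAbove (hy k)
    refine ⟨B + 1, fun l hl hfr => ?_⟩
    refine finite_column_of_not_frequently (h.injective k l) (h.col k l) (y := y ∩ A k) ?_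
      (hfr.mono fun b hb => ⟨hb, h.mem k l b⟩)
    by_contra hcon
    have h₁ : c k l ≤ B := hB hcon
    have h₂ := h.le_col k l
    omega
  choose B hB using hB
  have hnext : ∀ k : W, ∃ l : W, k.1 < l.1 ∧ B k ≤ l := fun k => by
    obtain ⟨l, hl, hkl⟩ := hW.exists_gt (max k.1 (B k))
    exact ⟨⟨l, hl⟩, (le_max_left _ _).trans_lt hkl, ((le_max_right _ _).trans_lt hkl).le⟩
  choose g hg hg' using hnext
  obtain ⟨w, hw⟩ := hW.nonempty
  let u : ℕ → W := fun n => g^[n] ⟨w, hw⟩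
  have hu : ∀ n, u (n + 1) = g (u n) := fun n => Function.iterate_succ_apply' g n _
  have hmono : StrictMono fun n => (u n).1 := strictMono_nat_of_lt_succ fun n => by
    rw [hu]
    exact hg _
  refine ⟨range fun n => (u n).1, ?_, infinite_range_of_injective hmono.injective, fun hm => ?_⟩
  · rintro _ ⟨n, rfl⟩
    exact (u n).2
  · obtain ⟨k, l, ⟨hk, hl, hkl, -⟩, hact⟩ := hm.exists
    obtain ⟨i, rfl⟩ := hk
    obtain ⟨j, rfl⟩ := hl
    have hij : i + 1 ≤ j := hmono.lt_iff_lt.1 hkl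
    refine hB _ _ ?_ (hact.mono fun b hb => hb.2)
    refine le_trans ?_ (hmono.monotone hij)
    simp only [hu]
    exact hg' (u i)

/-- A map into an almost disjoint family cannot both be decided by initial segments below `W` and assign to
each infinite subset of `W` a member of the family meeting it often. -/
theorem IsPointSystem.false_of_decidedAt (h : IsPointSystem A pt c) {𝒜 : Set (Set (ℕ × ℕ))}
    (h𝒜 : IsADFamily finTwo 𝒜) (hA : ∀ n, A n ∈ 𝒜) {W : Set ℕ} (hW : W.Infinite)
    {F : Set ℕ → Set (ℕ × ℕ)}
    (hdec : ∀ m ∈ W, ∀ k ≤ m, ∀ l ≤ m, DecidedAt W m fun z => ActiveIn (pt k l) z (F z))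
    (hdec' : ∀ m ∈ W, ∀ k ≤ m, ∀ l ≤ m, DecidedAt W m fun z => pt k l m ∈ F z)
    (hdec₂ : ∀ m ∈ W, ∀ i ≤ m, ∀ j ≤ m, DecidedAt W m fun z => (i, j) ∈ F z)
    (hF : ∀ z ⊆ W, z.Infinite → F z ∈ 𝒜 ∧ MeetsOften pt z (F z)) : False := by
  have hne : ∀ n, F W ≠ A n := fun n e =>
    h.not_meetsOften_self W n (e ▸ (hF W Subset.rfl hW).2)
  obtain ⟨z, hz, hzi, hcon⟩ := h.exists_not_meetsOften
    (fun k => h𝒜.2 _ (hF W Subset.rfl hW).1 _ (hA k) (hne k)) hW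
  refine hcon ?_
  rw [eq_of_decidedAt hW h.injective h.col h.le_col hdec hdec' hdec₂
    (fun z hz hzi => (hF z hz hzi).2)
    (fun z hz hzi z' hz' hzi' hint => by_contra fun hne =>
      hint (h𝒜.2 _ (hF z hz hzi).1 _ (hF z' hz' hzi').1 hne)) Subset.rfl hW hz hzi]
  exact (hF z hz hzi).2

end FinTwoMad

namespace FinTwoMad

open Filter

/-! ### The space of infinite sets is Polish -/

theorem isClopen_apply_eq {S : Type} (s : S) (b : Bool) : IsClopen {x : S → Bool | x s = b} :=
  (isClopen_discrete {b}).preimage (continuous_apply s)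

instance {S : Type} [Countable S] : PolishSpace (S → Bool) where
  toSecondCountableTopology := inferInstance
  toIsCompletelyMetrizableSpace := inferInstance

open Classical in
/-- An infinite set together with the function sending each number to the next larger element. -/
noncomputable def withNext (x : InfSubset) : (ℕ → Bool) × (ℕ → ℕ) :=
  (x.1, fun n => Nat.find (x.2.exists_gt n))

theorem withNext_spec (x : InfSubset) (n : ℕ) :
    x.1 ((withNext x).2 n) = true ∧ n < (withNext x).2 n ∧
      ∀ j < (withNext x).2 n, n < j → x.1 j = false := by
  classical
  refine ⟨(Nat.find_spec (x.2.exists_gt n)).1, (Nat.find_spec (x.2.exists_gt n)).2, ?_⟩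
  intro j hj hnj
  by_contra hx
  exact Nat.find_min (x.2.exists_gt n) (by convert! hj) ⟨by simpa [toSet] using hx, hnj⟩

theorem isClosed_next (n : ℕ) : IsClosed {p : (ℕ → Bool) × (ℕ → ℕ) |
    p.1 (p.2 n) = true ∧ n < p.2 n ∧ ∀ j < p.2 n, n < j → p.1 j = false} := by
  have hopen : ∀ k j : ℕ, IsOpen {p : (ℕ → Bool) × (ℕ → ℕ) | p.2 n = k ∧ p.1 j = true} ∧
      IsOpen {p : (ℕ → Bool) × (ℕ → ℕ) | p.2 n = k ∧ p.1 j = false} := fun k j => by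
    have h₁ : IsOpen {p : (ℕ → Bool) × (ℕ → ℕ) | p.2 n = k} :=
      (isOpen_discrete ({k} : Set ℕ)).preimage
        (show Continuous fun p : (ℕ → Bool) × (ℕ → ℕ) => p.2 n from
          (continuous_apply n).comp continuous_snd)
    exact ⟨h₁.inter ((isClopen_apply_eq j true).isOpen.preimage continuous_fst),
      h₁.inter ((isClopen_apply_eq j false).isOpen.preimage continuous_fst)⟩
  have hk : ∀ k, IsOpen {p : (ℕ → Bool) × (ℕ → ℕ) | p.2 n = k} := fun k =>
    (isOpen_discrete ({k} : Set ℕ)).preimage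
        (show Continuous fun p : (ℕ → Bool) × (ℕ → ℕ) => p.2 n from
          (continuous_apply n).comp continuous_snd)
  rw [← isOpen_compl_iff]
  have : {p : (ℕ → Bool) × (ℕ → ℕ) |
      p.1 (p.2 n) = true ∧ n < p.2 n ∧ ∀ j < p.2 n, n < j → p.1 j = false}ᶜ =
      (⋃ k, {p | p.2 n = k ∧ p.1 k = false}) ∪ (⋃ k ∈ Iic n, {p | p.2 n = k}) ∪
        ⋃ k, ⋃ j ∈ Ioo n k, {p | p.2 n = k ∧ p.1 j = true} := by
    ext p
    simp only [mem_compl_iff, mem_ofPred_eq, mem_union, mem_iUnion, mem_Iic, mem_Ioo, not_and_or,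
      not_forall, exists_prop, not_lt, Bool.not_eq_true, Bool.not_eq_false]
    constructor
    · rintro (h | h | ⟨j, h₁, h₂, h₃⟩)
      · exact Or.inl (Or.inl ⟨_, rfl, h⟩)
      · exact Or.inl (Or.inr ⟨_, h, rfl⟩)
      · exact Or.inr ⟨_, j, ⟨h₂, h₁⟩, rfl, h₃⟩
    · rintro ((⟨k, rfl, h⟩ | ⟨k, h, rfl⟩) | ⟨k, j, ⟨h₂, h₁⟩, rfl, h₃⟩)
      · exact Or.inl h
      · exact Or.inr (Or.inl h)
      · exact Or.inr (Or.inr ⟨j, h₁, h₂, h₃⟩)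
  rw [this]
  exact ((isOpen_iUnion fun k => (hopen k k).2).union
    (isOpen_biUnion fun k _ => hk k)).union
    (isOpen_iUnion fun k => isOpen_biUnion fun j _ => (hopen k j).1)

theorem continuous_withNext : Continuous withNext := by
  classical
  refine continuous_subtype_val.prodMk (continuous_pi fun n => ?_)
  refine continuous_discrete_rng.2 fun k => ?_
  have : (fun x : InfSubset => Nat.find (x.2.exists_gt n)) ⁻¹' {k} =
      {x | (x.1 k = true ∧ n < k) ∧ ∀ j ∈ Iio k, ¬ (x.1 j = true ∧ n < j)} := by
    ext x
    exact Nat.find_eq_iff _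
  rw [this]
  have hopen : ∀ j b, IsOpen {x : InfSubset | x.1 j = b} := fun j b =>
    (isClopen_apply_eq j b).isOpen.preimage continuous_subtype_val
  have hlow : {x : InfSubset | ∀ j ∈ Iio k, ¬ (x.1 j = true ∧ n < j)} =
      ⋂ j ∈ Iio k, {x | x.1 j = false} ∪ {_x | ¬ n < j} := by
    ext x
    simp [imp_iff_not_or]
  refine ((hopen k true).inter isOpen_const).inter (t := {x : InfSubset | _}) ?_
  rw [hlow]
  exact (finite_Iio k).isOpen_biInter fun j _ => (hopen j false).union isOpen_const

/-- The infinite sets are not closed in the Cantor space, but adding the next-element function as a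
second coordinate makes their image closed. -/
instance : PolishSpace InfSubset := by
  classical
  have hemb : Topology.IsClosedEmbedding withNext := by
    refine ⟨Topology.IsEmbedding.of_comp continuous_withNext continuous_fst
      Topology.IsEmbedding.subtypeVal, ?_⟩
    have : range withNext = ⋂ n, {p : (ℕ → Bool) × (ℕ → ℕ) |
        p.1 (p.2 n) = true ∧ n < p.2 n ∧ ∀ j < p.2 n, n < j → p.1 j = false} := by
      ext p
      constructor
      · rintro ⟨x, rfl⟩
        exact mem_iInter.2 fun n => withNext_spec x n
      · intro hp
        have hp : ∀ n, _ := mem_iInter.1 hp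
        refine ⟨⟨p.1, Set.infinite_of_forall_exists_gt fun n => ⟨p.2 n, (hp n).1, (hp n).2.1⟩⟩,
          Prod.ext rfl (funext fun n => ?_)⟩
        refine (Nat.find_eq_iff _).2 ⟨⟨(hp n).1, (hp n).2.1⟩, fun j hj h => ?_⟩
        have h₁ : p.1 j = true := h.1
        exact absurd ((hp n).2.2 j hj h.2) (by simp [h₁])
    rw [this]
    exact isClosed_iInter isClosed_next
  exact hemb.polishSpace

instance (A : InfSubset) : PolishSpace (infSubsetsOf A) := by
  refine IsClosed.polishSpace ?_
  have : infSubsetsOf A = ⋂ n ∈ (toSet A.1)ᶜ, {x : InfSubset | x.1 n = false} := by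
    ext x
    simp only [infSubsetsOf, mem_ofPred_eq, mem_iInter, mem_compl_iff]
    constructor
    · intro h n hn
      by_contra hx
      exact hn (h (by simpa [toSet] using hx))
    · intro h n hn
      by_contra hx
      have h₁ : x.1 n = true := hn
      simp [h n hx] at h₁
  rw [this]
  exact isClosed_biInter fun n _ =>
    (isClopen_apply_eq n false).isClosed.preimage continuous_subtype_val

/-! ### Passing to infinite subsets of a given set -/

open Classical in
/-- The infinite set `z` as a point of the space of infinite sets. -/
noncomputable def ofSet (z : Set ℕ) (hz : z.Infinite) : InfSubset :=
  ⟨fun n => decide (n ∈ z), by simpa [toSet] using hz⟩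

@[simp]
theorem toSet_ofSet (z : Set ℕ) (hz : z.Infinite) : toSet (ofSet z hz).1 = z := by
  simp [toSet, ofSet]

theorem toSet_injective {S : Type} : Function.Injective (toSet : (S → Bool) → Set S) :=
  fun _ _ h => funext fun s => Bool.eq_iff_iff.2 (Set.ext_iff.1 h s)

open Classical in
theorem infinite_adjoin {V : Set ℕ} (hV : V.Infinite) (x : InfSubset) :
    {n ∈ V | Nat.count (· ∈ V) n ∈ toSet x.1}.Infinite := by
  refine (x.2.image (f := Nat.nth (· ∈ V)) (Nat.nth_injective (p := (· ∈ V)) hV).injOn).mono ?_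
  rintro _ ⟨i, hi, rfl⟩
  refine ⟨Nat.nth_mem_of_infinite hV i, ?_⟩
  rwa [Nat.count_nth_of_infinite (p := (· ∈ V)) hV]

open Classical in
/-- The union of `s` with the subset of `V` whose indices in the enumeration of `V` are the
elements of `x`. -/
noncomputable def adjoin (s V : Set ℕ) (hV : V.Infinite) (x : InfSubset) : InfSubset :=
  ⟨fun n => decide (n ∈ s) || (decide (n ∈ V) && x.1 (Nat.count (· ∈ V) n)),
    (infinite_adjoin hV x).mono fun n hn => by
      have h₁ : x.1 (Nat.count (· ∈ V) n) = true := hn.2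
      simp [toSet, hn.1, h₁]⟩

open Classical in
theorem toSet_adjoin (s V : Set ℕ) (hV : V.Infinite) (x : InfSubset) :
    toSet (adjoin s V hV x).1 = s ∪ {n ∈ V | Nat.count (· ∈ V) n ∈ toSet x.1} := by
  ext n
  simp [toSet, adjoin]

theorem toSet_adjoin_subset {s V W : Set ℕ} (hs : s ⊆ W) (hVW : V ⊆ W) (hV : V.Infinite)
    (x : InfSubset) : toSet (adjoin s V hV x).1 ⊆ W := by
  rw [toSet_adjoin]
  exact union_subset hs fun n hn => hVW hn.1

theorem continuous_adjoin (s V : Set ℕ) (hV : V.Infinite) : Continuous (adjoin s V hV) := by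
  classical
  refine Continuous.subtype_mk (continuous_pi fun n => ?_) _
  have h : Continuous fun x : InfSubset => x.1 (Nat.count (· ∈ V) n) :=
    (continuous_apply _).comp continuous_subtype_val
  exact (continuous_of_discreteTopology
    (f := fun b : Bool => decide (n ∈ s) || (decide (n ∈ V) && b))).comp h

/-- `IsRamsey` gives a homogeneous set with no control over where it lies. Transporting along the
enumeration of `V` places it inside `V`. -/
theorem exists_constantOn_of_isRamsey {Q : Set ℕ → Prop} {s V : Set ℕ} (hV : V.Infinite)
    (h : IsRamsey {x | Q (toSet (adjoin s V hV x).1)}) :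
    ∃ V' ⊆ V, V'.Infinite ∧ ConstantOn Q s V' := by
  classical
  obtain ⟨A, hA⟩ := h
  refine ⟨{n ∈ V | Nat.count (· ∈ V) n ∈ toSet A.1}, fun n hn => hn.1, infinite_adjoin hV A, ?_⟩
  have key : ∀ v ⊆ {n ∈ V | Nat.count (· ∈ V) n ∈ toSet A.1}, v.Infinite →
      ∃ x ∈ infSubsetsOf A, toSet (adjoin s V hV x).1 = s ∪ v := by
    intro v hv hvi
    have hinj : InjOn (Nat.count (· ∈ V)) v := fun a ha b hb e => by
      rw [← Nat.nth_count (p := (· ∈ V)) (hv ha).1, e, Nat.nth_count (p := (· ∈ V)) (hv hb).1]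
    refine ⟨ofSet _ (hvi.image hinj), ?_, ?_⟩
    · change toSet (ofSet _ _).1 ⊆ _
      rw [toSet_ofSet]
      rintro _ ⟨n, hn, rfl⟩
      exact (hv hn).2
    · rw [toSet_adjoin, toSet_ofSet]
      congr 1
      ext n
      constructor
      · rintro ⟨hn, a, ha, e⟩
        have e : Nat.count (· ∈ V) a = Nat.count (· ∈ V) n := e
        rwa [← Nat.nth_count (p := (· ∈ V)) hn, ← e, Nat.nth_count (p := (· ∈ V)) (hv ha).1]
      · exact fun hn => ⟨(hv hn).1, n, hn, rfl⟩
  refine hA.imp (fun hA v hv hvi => ?_) (fun hA v hv hvi => ?_)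
  · obtain ⟨x, hx, e⟩ := key v hv hvi
    exact e ▸ hA hx
  · obtain ⟨x, hx, e⟩ := key v hv hvi
    exact e ▸ hA hx

theorem isOpen_mem_toSet (n : ℕ) : IsOpen {x : InfSubset | n ∈ toSet x.1} :=
  (isClopen_apply_eq n true).isOpen.preimage continuous_subtype_val

/-- The set depends only on the finitely many coordinates up to `m`, so it is the preimage of a
subset of a finite discrete space. -/
theorem DecidedAt.isOpen {W : Set ℕ} {m : ℕ} {Q : Set ℕ → Prop} (h : DecidedAt W m Q)
    {s V : Set ℕ} (hs : s ⊆ W) (hVW : V ⊆ W) (hV : V.Infinite) :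
    IsOpen {x | Q (toSet (adjoin s V hV x).1)} := by
  let g : InfSubset → Iic m → Bool := fun x i => (adjoin s V hV x).1 i
  have hg : Continuous g := continuous_pi fun i =>
    (continuous_apply _).comp (continuous_subtype_val.comp (continuous_adjoin s V hV))
  have : {x | Q (toSet (adjoin s V hV x).1)} =
      g ⁻¹' (g '' {x | Q (toSet (adjoin s V hV x).1)}) := by
    refine (subset_preimage_image _ _).antisymm ?_
    rintro x ⟨y, hy, e⟩
    refine (h _ (toSet_adjoin_subset hs hVW hV y) (adjoin s V hV y).2 _
      (toSet_adjoin_subset hs hVW hV x) (adjoin s V hV x).2 ?_).1 hy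
    ext i
    refine and_congr_left fun hi => ?_
    have := congrFun e ⟨i, hi⟩
    exact Bool.eq_iff_iff.1 this
  rw [this]
  exact (isOpen_discrete _).preimage hg

end FinTwoMad

namespace FinTwoMad

open Filter

/-! ### Dedekind infinite mad families -/

theorem measurable_activeIn {X : Type} [MeasurableSpace X] (p : ℕ → ℕ × ℕ) {z : X → Set ℕ}
    {y : X → Set (ℕ × ℕ)} (hz : ∀ n, Measurable fun x => n ∈ z x)
    (hy : ∀ q, Measurable fun x => q ∈ y x) : Measurable fun x => ActiveIn p (z x) (y x) := by
  simp only [ActiveIn, frequently_atTop]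
  exact Measurable.forall fun _ => Measurable.exists fun b =>
    measurable_const.and ((hz b).and (hy (p b)))

theorem measurable_meetsOften {X : Type} [MeasurableSpace X] (pt : ℕ → ℕ → ℕ → ℕ × ℕ)
    {z : X → Set ℕ} {y : X → Set (ℕ × ℕ)} (hz : ∀ n, Measurable fun x => n ∈ z x)
    (hy : ∀ q, Measurable fun x => q ∈ y x) : Measurable fun x => MeetsOften pt (z x) (y x) := by
  have hadj : ∀ k l, Measurable fun x => AdjacentIn (z x) k l := fun k l =>
    (hz k).and ((hz l).and (measurable_const.and (Measurable.forall fun j =>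
      measurable_const.imp (measurable_const.imp (hz j).not))))
  simp only [MeetsOften, frequently_atTop]
  exact Measurable.forall fun _ => Measurable.exists fun k =>
    measurable_const.and (Measurable.exists fun l =>
      (hadj k l).and (measurable_activeIn _ hz hy))

/-- An infinite set of natural numbers, read as a subset of `ℕ × ℕ` through the pairing. -/
def unpairSet (y : InfSubset) : ℕ × ℕ → Bool := fun q => y.1 (Nat.pair q.1 q.2)

theorem continuous_unpairSet : Continuous unpairSet :=
  continuous_pi fun _ => (continuous_apply _).comp continuous_subtype_val

/-- Sets outside the ideal are infinite, so members of the family can be coded in `InfSubset`, where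
the relation to be uniformised lives. -/
theorem exists_unpairSet {y : Set (ℕ × ℕ)} (hy : y ∉ finTwo) :
    ∃ x, toSet (unpairSet x) = y := by
  have hinf : y.Infinite := fun hfin => hy <| by
    refine (hfin.image Prod.fst).subset fun n hn => ?_
    obtain ⟨m, hm⟩ := Set.Infinite.nonempty hn
    exact ⟨(n, m), hm, rfl⟩
  refine ⟨ofSet ((fun q : ℕ × ℕ => Nat.pair q.1 q.2) '' y)
    (hinf.image fun q _ q' _ e => Nat.pairEquiv.injective e), ?_⟩
  ext q
  have h : q ∈ toSet (unpairSet (ofSet ((fun q : ℕ × ℕ => Nat.pair q.1 q.2) '' y)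
      (hinf.image fun q _ q' _ e => Nat.pairEquiv.injective e))) ↔
      Nat.pair q.1 q.2 ∈ toSet (ofSet ((fun q : ℕ × ℕ => Nat.pair q.1 q.2) '' y)
      (hinf.image fun q _ q' _ e => Nat.pairEquiv.injective e)).1 := Iff.rfl
  rw [h, toSet_ofSet]
  exact ⟨fun ⟨q', hq', e⟩ => Nat.pairEquiv.injective e ▸ hq', fun hq => ⟨q, hq, rfl⟩⟩

open Classical in
/-- The value of `f`, read as a subset of `ℕ × ℕ`, at an infinite subset of `A`. -/
noncomputable def valueAt {A : InfSubset} (f : infSubsetsOf A → InfSubset) (z : Set ℕ) :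
    Set (ℕ × ℕ) :=
  if h : z.Infinite ∧ z ⊆ toSet A.1 then
    toSet (unpairSet (f ⟨ofSet z h.1, by simpa [infSubsetsOf] using h.2⟩))
  else ∅

theorem valueAt_toSet {A : InfSubset} (f : infSubsetsOf A → InfSubset) (x : infSubsetsOf A) :
    valueAt f (toSet x.1.1) = toSet (unpairSet (f x)) := by
  rw [valueAt, dif_pos ⟨x.1.2, x.2⟩]
  congr 3
  exact Subtype.ext (Subtype.ext (toSet_injective (toSet_ofSet _ x.1.2)))

/-- Every total relation in `Γ` is uniformised on some `[A]^∞` by a function measurable for some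
pointclass all of whose sets are Ramsey. -/
def HasMeasurableUniformisations (Γ : SetClass) : Prop :=
  ∀ R : Set (InfSubset × InfSubset), R ∈ Γ (InfSubset × InfSubset) → IsTotalRel R →
    ∃ (A : InfSubset) (f : infSubsetsOf A → InfSubset), Uniformises R A f ∧
      ∃ Γ' : SetClass, IsPointclass Γ' ∧ MeasurableFor Γ' f ∧ AllRamsey Γ'

/-- A measurable function on `[A]^∞` is decided, together with the Borel predicates
`ActiveIn (pt k l) z (f z)`, by initial segments below some infinite subset of `A`. -/
theorem exists_decidedAt_of_measurableFor {Γ : SetClass} (hΓ : IsPointclass Γ)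
    (hR : AllRamsey Γ) {A : InfSubset} {f : infSubsetsOf A → InfSubset}
    (hf : MeasurableFor Γ f) (pt : ℕ → ℕ → ℕ → ℕ × ℕ) :
    ∃ W ⊆ toSet A.1, W.Infinite ∧
      (∀ m ∈ W, ∀ k ≤ m, ∀ l ≤ m, DecidedAt W m fun z => ActiveIn (pt k l) z (valueAt f z)) ∧
      (∀ m ∈ W, ∀ k ≤ m, ∀ l ≤ m, DecidedAt W m fun z => pt k l m ∈ valueAt f z) ∧
      ∀ m ∈ W, ∀ i ≤ m, ∀ j ≤ m, DecidedAt W m fun z => (i, j) ∈ valueAt f z := by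
  classical
  obtain ⟨W₁, hW₁, hW₁i, hdec₁⟩ := exists_decidedAt
    (fun (q : ℕ × ℕ) z => q ∈ valueAt f z)
    -- The image is added because the coordinates of `pt k l m` may exceed `m`.
    (fun m => Finset.Iic m ×ˢ Finset.Iic m ∪
      (Finset.Iic m ×ˢ Finset.Iic m).image fun p => pt p.1 p.2 m) (toSet A.1) A.2 (by
    intro q s hs _ V hV hVi
    refine exists_constantOn_of_isRamsey hVi (hR _ ?_)
    let e : InfSubset → infSubsetsOf A := fun x =>
      ⟨adjoin s V hVi x, toSet_adjoin_subset hs hV hVi x⟩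
    have he : Continuous e := (continuous_adjoin s V hVi).subtype_mk _
    have hU : IsOpen {y | q ∈ toSet (unpairSet y)} := isOpen_mem_toSet _
    have : {x | q ∈ valueAt f (toSet (adjoin s V hVi x).1)} =
        e ⁻¹' (f ⁻¹' {y | q ∈ toSet (unpairSet y)}) := by
      ext x
      change q ∈ valueAt f (toSet (e x).1.1) ↔ _
      rw [valueAt_toSet]
      rfl
    rw [this]
    exact hΓ.preimage _ _ e he _ (hf _ hU))
  have hdec₂ : ∀ m ∈ W₁, ∀ i ≤ m, ∀ j ≤ m, DecidedAt W₁ m fun z => (i, j) ∈ valueAt f z :=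
    fun m hm i hi j hj => hdec₁ m hm (i, j) (by simp [hi, hj])
  -- A pointclass need not be closed under countable unions, so activity is handled in a second
  -- fusion. Below `W₁` membership in the value is already open, which makes activity Borel.
  obtain ⟨W₂, hW₂, hW₂i, hdec⟩ := exists_decidedAt
    (fun (p : ℕ × ℕ) z => ActiveIn (pt p.1 p.2) z (valueAt f z))
    (fun m => Finset.Iic m ×ˢ Finset.Iic m) W₁ hW₁i (by
    intro p s hs _ V hV hVi
    refine exists_constantOn_of_isRamsey hVi (hR _ (hΓ.borel _ _ ?_))
    let _ : MeasurableSpace InfSubset := borel InfSubset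
    have _ : BorelSpace InfSubset := ⟨rfl⟩
    refine measurableSet_setOfPred.2 (measurable_activeIn _ (fun n => ?_) fun q => ?_)
    · exact measurableSet_setOfPred.1
        ((isOpen_mem_toSet n).preimage (continuous_adjoin s V hVi)).measurableSet
    · obtain ⟨m, hm, hqm⟩ := hW₁i.exists_gt (max q.1 q.2)
      exact measurableSet_setOfPred.1 ((hdec₂ m hm q.1 ((le_max_left _ _).trans hqm.le) q.2
        ((le_max_right _ _).trans hqm.le)).isOpen hs hV hVi).measurableSet)
  refine ⟨W₂, hW₂.trans hW₁, hW₂i, fun m hm k hk l hl => ?_, fun m hm k hk l hl => ?_,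
    fun m hm i hi j hj => (hdec₂ m (hW₂ hm) i hi j hj).mono hW₂⟩
  · exact hdec m hm (k, l) (by simp [hk, hl])
  · refine (hdec₁ m (hW₂ hm) (pt k l m) (Finset.mem_union_right _ ?_)).mono hW₂
    exact Finset.mem_image.2 ⟨(k, l), by simp [hk, hl], rfl⟩

theorem not_exists_dedekindInfinite_mad {Γ : SetClass} (hΓ : IsPointclass Γ)
    (hU : HasMeasurableUniformisations Γ) :
    ¬ ∃ 𝒜 : Set (Set (ℕ × ℕ)),
      IsMadFamily finTwo 𝒜 ∧ DedekindInfinite 𝒜 ∧ FamilyIn Γ 𝒜 := by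
  rintro ⟨𝒜, hmad, ⟨g, hg⟩, h𝒜⟩
  obtain ⟨pt, c, hpt⟩ := exists_isPointSystem (A := fun n => (g n).1)
    (fun n => hmad.1.1 _ (g n).2)
    (fun n k hnk => hmad.1.2 _ (g k).2 _ (g n).2 fun e => hnk (hg (Subtype.ext e)).symm)
  obtain ⟨A, f, hf, Γ', hΓ', hmeas, hR⟩ := hU
    ({p | toSet (unpairSet p.2) ∈ 𝒜} ∩
      {p | MeetsOften pt (toSet p.1.1) (toSet (unpairSet p.2))}) (by
    refine hΓ.inter _ _ ?_ _ (hΓ.borel _ _ ?_)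
    · exact hΓ.preimage _ _ (fun p : InfSubset × InfSubset => unpairSet p.2)
        (continuous_unpairSet.comp continuous_snd) _ h𝒜
    · let _ : MeasurableSpace (InfSubset × InfSubset) := borel _
      have _ : BorelSpace (InfSubset × InfSubset) := ⟨rfl⟩
      refine measurableSet_setOfPred.2 (measurable_meetsOften pt (fun n => ?_) fun q => ?_)
      · exact measurableSet_setOfPred.1
          ((isOpen_mem_toSet n).preimage continuous_fst).measurableSet
      · exact measurableSet_setOfPred.1
          ((isOpen_mem_toSet (Nat.pair q.1 q.2)).preimage continuous_snd).measurableSet)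
    (fun z => by
      obtain ⟨y, hy, hyz⟩ := hmad.exists_inter_notMem (hpt.pointsOf_notMem_finTwo z.2)
      obtain ⟨x, rfl⟩ := exists_unpairSet (hmad.1.1 y hy)
      exact ⟨x, hy, hpt.meetsOften hyz⟩)
  obtain ⟨W, hWA, hW, hdec, hdec', hdec₂⟩ := exists_decidedAt_of_measurableFor hΓ' hR hmeas pt
  refine hpt.false_of_decidedAt hmad.1 (fun n => (g n).2) hW hdec hdec' hdec₂ fun z hz hzi => ?_
  let x : infSubsetsOf A := ⟨ofSet z hzi, by simpa [infSubsetsOf] using hz.trans hWA⟩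
  have hx := hf x
  have hxz : toSet x.1.1 = z := toSet_ofSet z hzi
  rw [← hxz, valueAt_toSet]
  exact hx

end FinTwoMad

namespace FinTwoMad

open MeasureTheory

/-! ### The projective sets form a pointclass closed under projections -/

/-- The two halves of a sequence. -/
def halves (w : ℕ → ℕ) : (ℕ → ℕ) × (ℕ → ℕ) := (fun n => w (2 * n), fun n => w (2 * n + 1))

theorem continuous_halves : Continuous halves :=
  (continuous_pi fun _ => continuous_apply _).prodMk (continuous_pi fun _ => continuous_apply _)

theorem surjective_halves : Function.Surjective halves := by
  rintro ⟨u, v⟩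
  refine ⟨fun n => if n % 2 = 0 then u (n / 2) else v (n / 2), Prod.ext ?_ ?_⟩
  · funext n
    simp [halves]
  · funext n
    simp only [halves]
    rw [if_neg (by omega), show (2 * n + 1) / 2 = n by omega]

theorem sigmaOne_preimage (n : ℕ) {X Y : Type} [TopologicalSpace X] [PolishSpace X]
    [TopologicalSpace Y] [PolishSpace Y] {g : X → Y} (hg : Continuous g) {s : Set Y}
    (hs : s ∈ sigmaOne n Y) : g ⁻¹' s ∈ sigmaOne n X := by
  induction n generalizing X Y with
  | zero => exact AnalyticSet.preimage hs hg
  | succ n ih =>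
    obtain ⟨t, ht, rfl⟩ := hs
    refine ⟨Prod.map g id ⁻¹' t, ?_, ?_⟩
    · rw [← preimage_compl]
      exact ih (hg.prodMap continuous_id) ht
    · ext x
      constructor
      · rintro ⟨⟨y, w⟩, hp, e⟩
        have e : y = g x := e
        subst e
        exact ⟨(x, w), hp, rfl⟩
      · rintro ⟨⟨x, w⟩, hp, rfl⟩
        exact ⟨(g x, w), hp, rfl⟩

/-- The two closures are proved together because complementation exchanges them at the preceding
level. For intersections, `halves` codes two witnesses in one sequence. -/
theorem sigmaOne_union_inter (n : ℕ) {X : Type} [TopologicalSpace X] [PolishSpace X]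
    {s s' : Set X} (hs : s ∈ sigmaOne n X) (hs' : s' ∈ sigmaOne n X) :
    s ∪ s' ∈ sigmaOne n X ∧ s ∩ s' ∈ sigmaOne n X := by
  induction n generalizing X with
  | zero =>
    constructor
    · rw [union_eq_iUnion]
      exact AnalyticSet.iUnion (Bool.forall_bool.2 ⟨hs', hs⟩)
    · rw [inter_eq_iInter]
      exact AnalyticSet.iInter (Bool.forall_bool.2 ⟨hs', hs⟩)
  | succ n ih =>
    obtain ⟨t, ht, rfl⟩ := hs
    obtain ⟨t', ht', rfl⟩ := hs'
    constructor
    · refine ⟨t ∪ t', ?_, (image_union _ _ _).symm⟩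
      rw [compl_union]
      exact (ih ht ht').2
    · let g : X × (ℕ → ℕ) → X × (ℕ → ℕ) := fun p => (p.1, (halves p.2).1)
      let g' : X × (ℕ → ℕ) → X × (ℕ → ℕ) := fun p => (p.1, (halves p.2).2)
      have hg : Continuous g := continuous_fst.prodMk
        (continuous_fst.comp (continuous_halves.comp continuous_snd))
      have hg' : Continuous g' := continuous_fst.prodMk
        (continuous_snd.comp (continuous_halves.comp continuous_snd))
      refine ⟨g ⁻¹' t ∩ g' ⁻¹' t', ?_, ?_⟩
      · rw [compl_inter, ← preimage_compl, ← preimage_compl]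
        exact (ih (sigmaOne_preimage n hg ht) (sigmaOne_preimage n hg' ht')).1
      · ext x
        constructor
        · rintro ⟨⟨⟨x, u⟩, hu, rfl⟩, ⟨⟨x', v⟩, hv, e⟩⟩
          have e : x' = x := e
          subst e
          obtain ⟨w, hw⟩ := surjective_halves (u, v)
          refine ⟨(x', w), ⟨?_, ?_⟩, rfl⟩
          · change (x', (halves w).1) ∈ t
            rwa [hw]
          · change (x', (halves w).2) ∈ t'
            rwa [hw]
        · rintro ⟨p, ⟨h, h'⟩, rfl⟩
          exact ⟨⟨_, h, rfl⟩, ⟨_, h', rfl⟩⟩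

theorem sigmaOne_succ (n : ℕ) {X : Type} [TopologicalSpace X] [PolishSpace X] {s : Set X}
    (hs : s ∈ sigmaOne n X) : s ∈ sigmaOne (n + 1) X := by
  induction n generalizing X with
  | zero =>
    have hs : AnalyticSet s := hs
    rw [AnalyticSet] at hs
    rcases hs with rfl | ⟨g, hg, rfl⟩
    · refine ⟨∅, ?_, (image_empty _).symm⟩
      rw [compl_empty]
      exact isClosed_univ.analyticSet
    -- The range of `g` is the projection of its transposed graph, which is closed, so the
    -- complement is open and hence analytic.
    · refine ⟨{p | g p.2 = p.1}, ?_, ?_⟩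
      · have hcl : IsClosed {p : X × (ℕ → ℕ) | g p.2 = p.1} :=
          isClosed_eq (hg.comp continuous_snd) continuous_fst
        borelize (X × (ℕ → ℕ))
        exact hcl.isOpen_compl.measurableSet.analyticSet
      · ext x
        constructor
        · rintro ⟨w, rfl⟩
          exact ⟨(g w, w), rfl, rfl⟩
        · rintro ⟨⟨x, w⟩, hp, rfl⟩
          exact ⟨w, hp⟩
  | succ n ih =>
    obtain ⟨t, ht, rfl⟩ := hs
    exact ⟨t, ih ht, rfl⟩

theorem sigmaOne_mono {n m : ℕ} (h : n ≤ m) {X : Type} [TopologicalSpace X] [PolishSpace X]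
    {s : Set X} (hs : s ∈ sigmaOne n X) : s ∈ sigmaOne m X := by
  induction m, h using Nat.le_induction with
  | base => exact hs
  | succ m _ ih => exact sigmaOne_succ m ih

theorem sigmaOne_image_fst (n : ℕ) {X Y : Type} [TopologicalSpace X] [PolishSpace X]
    [TopologicalSpace Y] [PolishSpace Y] {t : Set (X × Y)} (ht : t ∈ sigmaOne n (X × Y)) :
    Prod.fst '' t ∈ sigmaOne n X := by
  cases n with
  | zero => exact AnalyticSet.image_of_continuous ht continuous_fst
  | succ n =>
    obtain ⟨u, hu, rfl⟩ := ht
    -- A nonempty Polish `Y` is a continuous image of the Baire space, so a point of `Y` and the old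
    -- witness can be coded in one sequence. The empty space has no such map.
    rcases isEmpty_or_nonempty Y with hY | hY
    · have : Prod.fst '' (Prod.fst '' u) = (∅ : Set X) := by
        rw [eq_empty_of_isEmpty (Prod.fst '' u), image_empty]
      rw [this]
      exact sigmaOne_mono (Nat.zero_le _) analyticSet_empty
    · obtain ⟨π, hπ, hπs⟩ := PolishSpace.exists_nat_nat_continuous_surjective Y
      let g : X × (ℕ → ℕ) → (X × Y) × (ℕ → ℕ) :=
        fun p => ((p.1, π (halves p.2).1), (halves p.2).2)
      have hg : Continuous g := (continuous_fst.prodMk (hπ.comp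
        (continuous_fst.comp (continuous_halves.comp continuous_snd)))).prodMk
        (continuous_snd.comp (continuous_halves.comp continuous_snd))
      refine ⟨g ⁻¹' u, ?_, ?_⟩
      · rw [← preimage_compl]
        exact sigmaOne_preimage n hg hu
      · ext x
        constructor
        · rintro ⟨_, ⟨⟨⟨x, y⟩, v⟩, hp, rfl⟩, rfl⟩
          obtain ⟨a, rfl⟩ := hπs y
          obtain ⟨w, hw⟩ := surjective_halves (a, v)
          refine ⟨(x, w), ?_, rfl⟩
          change ((x, π (halves w).1), (halves w).2) ∈ u
          rwa [hw]
        · rintro ⟨p, hp, rfl⟩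
          exact ⟨_, ⟨_, hp, rfl⟩, rfl⟩

theorem isPointclass_projectiveSets : IsPointclass projectiveSets where
  preimage X Y _ _ _ _ g hg s hs := by
    obtain ⟨n, hs⟩ := hs
    exact ⟨n, sigmaOne_preimage n hg hs⟩
  inter X _ _ s hs t ht := by
    obtain ⟨n, hs⟩ := hs
    obtain ⟨m, ht⟩ := ht
    exact ⟨max n m, (sigmaOne_union_inter _ (sigmaOne_mono (le_max_left n m) hs)
      (sigmaOne_mono (le_max_right n m) ht)).2⟩
  borel X _ _ s hs := by
    borelize X
    exact ⟨0, MeasurableSet.analyticSet hs⟩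

theorem closedUnderProjection_projectiveSets : ClosedUnderProjection projectiveSets := by
  rintro X Y _ _ _ _ t ⟨n, ht⟩
  exact ⟨n, sigmaOne_image_fst n ht⟩

theorem isPointclass_allSets : IsPointclass allSets :=
  ⟨fun _ _ _ _ _ _ _ _ _ _ => mem_univ _, fun _ _ _ _ _ _ _ => mem_univ _,
    fun _ _ _ _ _ => mem_univ _⟩

theorem closedUnderProjection_allSets : ClosedUnderProjection allSets :=
  fun _ _ _ _ _ _ _ _ => mem_univ _

/-! ### Infinite mad families -/

/-- A function whose graph belongs to a pointclass closed under projections is measurable. -/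
theorem measurableFor_of_graph {Γ : SetClass} (hΓ : IsPointclass Γ)
    (hproj : ClosedUnderProjection Γ) {A : InfSubset} {f : infSubsetsOf A → InfSubset}
    (hf : range (fun x : infSubsetsOf A => ((x : InfSubset), f x)) ∈ Γ (InfSubset × InfSubset)) :
    MeasurableFor Γ f := by
  intro U hU
  have hgraph := hΓ.preimage (infSubsetsOf A × InfSubset) (InfSubset × InfSubset)
    (fun p => (p.1.1, p.2)) ((continuous_subtype_val.comp continuous_fst).prodMk continuous_snd)
    _ hf
  have hopen : Prod.snd ⁻¹' U ∈ Γ (infSubsetsOf A × InfSubset) := by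
    refine hΓ.borel _ _ ?_
    borelize (infSubsetsOf A × InfSubset)
    exact (hU.preimage continuous_snd).measurableSet
  -- The preimage of `U` is the projection of the part of the graph lying over values in `U`.
  have h := hproj _ _ _ (hΓ.inter _ _ hgraph _ hopen)
  convert! h using 1
  ext x
  constructor
  · exact fun hx => ⟨(x, f x), ⟨⟨x, rfl⟩, hx⟩, rfl⟩
  · rintro ⟨⟨x, y⟩, ⟨⟨x', e⟩, hy⟩, rfl⟩
    obtain ⟨e₁, e₂⟩ := Prod.ext_iff.1 e
    have e₁ : x' = x := Subtype.ext e₁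
    have e₂ : f x' = y := e₂
    subst e₁ e₂
    exact hy

/-- Choice, through `Set.Infinite.natEmbedding`, turns an infinite family into a Dedekind infinite
one. -/
theorem not_exists_infinite_mad {Γ : SetClass} (hΓ : IsPointclass Γ)
    (hproj : ClosedUnderProjection Γ) (hU : RUnif Γ) (hR : AllRamsey Γ) :
    ¬ ∃ 𝒜 : Set (Set (ℕ × ℕ)), IsMadFamily finTwo 𝒜 ∧ 𝒜.Infinite ∧ FamilyIn Γ 𝒜 := by
  rintro ⟨𝒜, hmad, hinf, h𝒜⟩
  refine not_exists_dedekindInfinite_mad hΓ (fun R hRΓ hRt => ?_)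
    ⟨𝒜, hmad, ⟨hinf.natEmbedding, (hinf.natEmbedding).injective⟩, h𝒜⟩
  obtain ⟨A, f, hf, hgraph⟩ := hU R hRΓ hRt
  exact ⟨A, f, hf, Γ, hΓ, measurableFor_of_graph hΓ hproj hgraph, hR⟩

end FinTwoMad

open FinTwoMad in
theorem theoremt :
    (∀ Γ : SetClass, IsPointclass Γ →
      (∀ R : Set (InfSubset × InfSubset), R ∈ Γ (InfSubset × InfSubset) → IsTotalRel R →
        ∃ (A : InfSubset) (f : infSubsetsOf A → InfSubset), Uniformises R A f ∧
          ∃ Γ' : SetClass, IsPointclass Γ' ∧ MeasurableFor Γ' f ∧ AllRamsey Γ') →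
      ¬ ∃ 𝒜 : Set (Set (ℕ × ℕ)),
        IsMadFamily finTwo 𝒜 ∧ DedekindInfinite 𝒜 ∧ FamilyIn Γ 𝒜) ∧
    (∀ Γ : SetClass,
      (Γ = allSets ∨ Γ = projectiveSets ∨ (IsPointclass Γ ∧ ClosedUnderProjection Γ)) →
      DependentChoice → RUnif Γ → AllRamsey Γ →
      ¬ ∃ 𝒜 : Set (Set (ℕ × ℕ)),
        IsMadFamily finTwo 𝒜 ∧ 𝒜.Infinite ∧ FamilyIn Γ 𝒜) := by
  refine ⟨fun Γ hΓ hU => not_exists_dedekindInfinite_mad hΓ hU, fun Γ hΓ _ hU hR => ?_⟩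
  rcases hΓ with rfl | rfl | ⟨hΓ, hproj⟩
  · exact not_exists_infinite_mad isPointclass_allSets closedUnderProjection_allSets hU hR
  · exact not_exists_infinite_mad isPointclass_projectiveSets
      closedUnderProjection_projectiveSets hU hR
  · exact not_exists_infinite_mad hΓ hproj hU hR
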